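/- Let $\tau>0$, $U_f>0$, $U(r)=U_f(1-r)$, and let $h\in C^\infty(]0,1[,\mathbb R)$ satisfy $h'>0$ and $h(r)\to+\infty$ as $r\to1^-$. Let $\rho_0\in]0,1[$ satisfy the subcharacteristic condition $h'(\rho_0)-U_f>0$, and set \[ \lambda_1^0=\rho_0U_f>0,\qquad \lambda_2^0=\rho_0(U_f-h'(\rho_0))<0,\qquad \lambda_*=U(\rho_0)-\rho_0U_f . \] Consider the linearization of the Aw–Rascle–Zhang system around the constant flow $(\rho_0,U(\rho_0))$, \[ \partial_t\rho+U(\rho_0)\,\partial_x\rho+\rho_0\,\partial_xu=0,\qquad \partial_tu+(U(\rho_0)-\rho_0h'(\rho_0))\,\partial_xu+\frac1\tau(U_f\rho+u)=0, \] for $x\in\mathbb R$, $t\ge0$, with initial data $\rho|_{t=0}=\rho_i$, $u|_{t=0}=u_i$, where $\rho_i,u_i\in C^j(\mathbb R,\mathbb R)$ for some integer $j\ge2$. Then this problem has a unique classical (that is, $C^1$ on $\mathbb R\times[0,\infty)$) solution $(\rho,u)$, and $\rho,u\in C^j(\mathbb R\times[0,\infty),\mathbb R)$. Moreover there exist $a_L,b_L>0$,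 depending only on $\tau,\rho_0,U_f,h'(\rho_0)$, and, for all $n,k\in\mathbb N$, a constant $K_{n,k}>0$, depending only on $n,k,\tau,\rho_0,U_f,h'(\rho_0)$, such that whenever $k+n\le j$, for all $x\in\mathbb R$ and $t\ge0$, \[ \begin{aligned} &\left|\partial_t^n\partial_x^k\big(u(x+\lambda_*t,t)\big)\right|+\left|\partial_t^n\partial_x^k\big(\rho(x+\lambda_*t,t)\big)\right|\\ &\quad\le\frac{K_{n,k}}{(1+t)^{\frac12+\frac k2+n}}\int_{\lambda_2^0t}^{\lambda_1^0t}e^{-a_L\frac{y^2}{1+t}}\big(|u_i(x-y)|+|\rho_i(x-y)|\big)\,dy\\ &\qquad+K_{n,k}\,e^{-b_Lt}\sum_{m=0}^{n+k}\Big(\big(|\rho_i^{(m)}|+|u_i^{(m)}|\big)(x-\lambda_1^0t)+\big(|\rho_i^{(m)}|+|u_i^{(m)}|\big)(x-\lambda_2^0t)\Big). \end{aligned} \] Here $\partial_t^n\partial_x^k$ acts on the functions $(x,t)\mapsto u(x+\lambda_*t,t)$ and $(x,t)\mapsto\rho(x+\lambda_*t,t)$. -/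

import Mathlib

open Set Filter Topology MeasureTheory
open scoped ContDiff

noncomputable section

namespace ARZ

/-- Admissible pressure laws: `h` is smooth on `]0,1[`, with `h' > 0` there, and `h(r) → +∞`
as `r → 1⁻`. -/
structure IsPressure (h : ℝ → ℝ) : Prop where
  smooth : ContDiffOn ℝ ∞ h (Ioo 0 1)
  deriv_pos : ∀ r ∈ Ioo (0 : ℝ) 1, 0 < deriv h r
  blowup : Tendsto h (𝓝[<] 1) atTop

/-- The equilibrium speed `U(r) = U_f (1 - r)`. -/
def U (Uf r : ℝ) : ℝ := Uf * (1 - r)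

/-- `s_cc(ρ₀) = h'(ρ₀) - U_f`; the subcharacteristic condition is `s_cc(ρ₀) > 0`. -/
def scc (Uf : ℝ) (h : ℝ → ℝ) (ρ₀ : ℝ) : ℝ := deriv h ρ₀ - Uf

/-- `λ₁⁰ = ρ₀ U_f`. -/
def lam1 (Uf ρ₀ : ℝ) : ℝ := ρ₀ * Uf

/-- `λ₂⁰ = ρ₀ (U_f - h'(ρ₀))`. -/
def lam2 (Uf : ℝ) (h : ℝ → ℝ) (ρ₀ : ℝ) : ℝ := ρ₀ * (Uf - deriv h ρ₀)

/-- `λ_* = U(ρ₀) - ρ₀ U_f`. -/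
def lamStar (Uf ρ₀ : ℝ) : ℝ := U Uf ρ₀ - ρ₀ * Uf

/-- `f`, a function of `(x, t)`, is `C^j` on the closed half-plane `ℝ × [0, ∞)`. -/
def IsCk (j : ℕ) (f : ℝ → ℝ → ℝ) : Prop :=
  ContDiffOn ℝ j (fun z : ℝ × ℝ => f z.1 z.2) (univ ×ˢ Ici 0)

/-- `∂_t^n ∂_x^k f (x, t)` for `f` defined on `ℝ × [0, ∞)`; the time derivatives are one-sided
at `t = 0`. -/
def partialTX (n k : ℕ) (f : ℝ → ℝ → ℝ) (x t : ℝ) : ℝ :=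
  iteratedDerivWithin n (fun s => iteratedDeriv k (fun y => f y s) x) (Ici 0) t

/-- `(ρ, u)` is a classical (`C¹` up to `t = 0`) solution on `ℝ × [0, ∞)` of the linearization of
the Aw-Rascle-Zhang system around the constant flow `(ρ₀, U(ρ₀))`,
`∂_t ρ + U(ρ₀) ∂_x ρ + ρ₀ ∂_x u = 0`,
`∂_t u + (U(ρ₀) - ρ₀ h'(ρ₀)) ∂_x u + (1/τ) (U_f ρ + u) = 0`,
with initial data `(ρᵢ, uᵢ)`. -/
structure IsSolution (τ Uf : ℝ) (h : ℝ → ℝ) (ρ₀ : ℝ) (ρᵢ uᵢ : ℝ → ℝ) (ρ u : ℝ → ℝ → ℝ) :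
    Prop where
  regular_rho : IsCk 1 ρ
  regular_u : IsCk 1 u
  eq_rho : ∀ x t, 0 ≤ t →
    partialTX 1 0 ρ x t + U Uf ρ₀ * partialTX 0 1 ρ x t + ρ₀ * partialTX 0 1 u x t = 0
  eq_u : ∀ x t, 0 ≤ t →
    partialTX 1 0 u x t + (U Uf ρ₀ - ρ₀ * deriv h ρ₀) * partialTX 0 1 u x t
      + 1 / τ * (Uf * ρ x t + u x t) = 0
  init_rho : ∀ x, ρ x 0 = ρᵢ x
  init_u : ∀ x, u x 0 = uᵢ x

/-- The perturbation seen in the frame moving at speed `λ_*`: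
`(x, t) ↦ f (x + λ_* t, t)`. -/
def moving (Uf ρ₀ : ℝ) (f : ℝ → ℝ → ℝ) (x t : ℝ) : ℝ := f (x + lamStar Uf ρ₀ * t) t

end ARZ

end

/-! In the frame of speed λ_* the linearization diagonalizes. With p = h'(ρ₀), the Riemann
coordinates W = pρ + u and V = -u travel at the speeds λ₁⁰ and λ₂⁰. In characteristic coordinates ξ
= x - λ₁⁰t, η = x - λ₂⁰t the relaxation becomes the exchange ∂_η W = ∂_ξ V = -μW + νV. Here μ > 0,
and ν > 0 is exactly the subcharacteristic condition. This is a two-velocity switching process: W +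
V = pρ is conserved, and λ₁⁰ν + λ₂⁰μ = 0 (`hlam` below) says that the mean drift vanishes in this
frame.

Riemann's method solves the exchange system explicitly. The kernel is k(a, b) = exp(-a-b)
I₀(2√(ab)), taken at a = μ(η-q), b = ν(q-ξ) and integrated against the data for q between ξ and η.
Added to this are trace terms, which carry the data along the two characteristics.

Decay is read off the representation of k as the mean over |z| = 1 of exp(a(z-1) + b(1/z-1)), where
∂_a and ∂_b multiply the integrand by z-1 and 1/z-1. Moving the circle to its approximate saddle
radius gives a Gaussian in (a-b)²/(1+a+b), and each derivative gains (1+a+b)^(-1/2) (`abs_ker_le`).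
Between the characteristics a+b is comparable to t and a-b = (μ+ν)(x-q), so this is a Gaussian in
(x-q)²/(1+t). An x-derivative costs one kernel derivative. A t-derivative costs two: by zero drift
it acts as a multiple of ∂_a + ∂_b, and (∂_a + ∂_b)k = -∂_a∂_b k (`ker_succ_succ`). Hence the rate
1/2 + k/2 + n. Differentiating the end points of the integral produces traces, where a or b vanishes
and the Gaussian becomes exponentially small in t. The class `Rep` is built to be stable under these
operations, and `Rep.abs_le` bounds all its members.

Uniqueness needs no growth condition: finite propagation speed allows a Picard iteration on backward
cones (`diagonal_system_eq_zero`). -/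

noncomputable section

namespace ARZ

/-! ### Calculus of functions of two real variables -/

/-- The linear form `(s, t) ↦ a s + b t`. -/
def lin2 (a b : ℝ) : ℝ × ℝ →L[ℝ] ℝ :=
  a • ContinuousLinearMap.fst ℝ ℝ ℝ + b • ContinuousLinearMap.snd ℝ ℝ ℝ

@[simp] theorem lin2_apply (a b : ℝ) (z : ℝ × ℝ) : lin2 a b z = a * z.1 + b * z.2 := by
  simp [lin2]

/-- Continuity of the two partials upgrades them to a total derivative. All later regularity in (ξ,
η) of kernels and integral operators reduces to computing partials. -/
theorem hasFDerivAt_of_partials {f f₁ f₂ : ℝ → ℝ → ℝ}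
    (h₁ : ∀ a b, HasDerivAt (fun s => f s b) (f₁ a b) a)
    (h₂ : ∀ a b, HasDerivAt (fun s => f a s) (f₂ a b) b)
    (c₁ : Continuous fun z : ℝ × ℝ => f₁ z.1 z.2)
    (c₂ : Continuous fun z : ℝ × ℝ => f₂ z.1 z.2) (a b : ℝ) :
    HasFDerivAt (fun z : ℝ × ℝ => f z.1 z.2) (lin2 (f₁ a b) (f₂ a b)) (a, b) := by
  have key := hasStrictFDerivAt_uncurry_coprod (𝕜 := ℝ) (u := (a, b)) (f := f)
    (f₁ := fun a b => ContinuousLinearMap.toSpanSingleton ℝ (f₁ a b))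
    (f₂ := fun a b => ContinuousLinearMap.toSpanSingleton ℝ (f₂ a b))
    (Eventually.of_forall fun v => (h₁ v.1 v.2).hasFDerivAt)
    (Eventually.of_forall fun v => (h₂ v.1 v.2).hasFDerivAt)
    ((ContinuousLinearMap.toSpanSingletonCLE (𝕜 := ℝ) (E := ℝ)).continuous.comp c₁).continuousAt
    ((ContinuousLinearMap.toSpanSingletonCLE (𝕜 := ℝ) (E := ℝ)).continuous.comp c₂).continuousAt
  refine HasFDerivAt.congr_fderiv (f := fun z : ℝ × ℝ => f z.1 z.2) key.hasFDerivAt ?_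
  ext <;> simp [Function.HasUncurry.uncurry]

theorem hasDerivAt_integral_of_continuous {F F' : ℝ → ℝ → ℝ}
    (cF : Continuous fun z : ℝ × ℝ => F z.1 z.2) (cF' : Continuous fun z : ℝ × ℝ => F' z.1 z.2)
    (h : ∀ a q, HasDerivAt (fun s => F s q) (F' a q) a) (p r a : ℝ) :
    HasDerivAt (fun s => ∫ q in p..r, F s q) (∫ q in p..r, F' a q) a := by
  have hK : IsCompact (Icc (a - 1) (a + 1) ×ˢ uIcc p r) := isCompact_Icc.prod isCompact_uIcc
  obtain ⟨C, hC⟩ := hK.exists_bound_of_continuousOn cF'.continuousOn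
  refine (intervalIntegral.hasDerivAt_integral_of_dominated_loc_of_deriv_le
    (F := F) (F' := F') (bound := fun _ => C) (s := Icc (a - 1) (a + 1))
    (Icc_mem_nhds (by linarith) (by linarith)) ?_ ?_ ?_ ?_ ?_ ?_).2
  · exact Eventually.of_forall fun s =>
      (cF.comp (Continuous.prodMk_right s)).aestronglyMeasurable
  · exact (cF.comp (Continuous.prodMk_right a)).intervalIntegrable _ _
  · exact (cF'.comp (Continuous.prodMk_right a)).aestronglyMeasurable
  · exact Eventually.of_forall fun q hq s hs => hC (s, q) ⟨hs, uIoc_subset_uIcc hq⟩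
  · exact intervalIntegrable_const
  · exact Eventually.of_forall fun q _ s _ => h s q

/-- Leibniz' rule with a variable upper end point. -/
theorem hasDerivAt_integral_upper {F F' : ℝ → ℝ → ℝ}
    (cF : Continuous fun z : ℝ × ℝ => F z.1 z.2) (cF' : Continuous fun z : ℝ × ℝ => F' z.1 z.2)
    (h : ∀ a q, HasDerivAt (fun s => F s q) (F' a q) a) (p a : ℝ) :
    HasDerivAt (fun s => ∫ q in p..s, F s q) ((∫ q in p..a, F' a q) + F a a) a := by
  have key := hasFDerivAt_of_partials (f := fun s r => ∫ q in p..r, F s q)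
    (f₁ := fun s r => ∫ q in p..r, F' s q) (f₂ := fun s r => F s r)
    (fun s r => hasDerivAt_integral_of_continuous cF cF' h p r s)
    (fun s r => by
      have c := cF.comp (Continuous.prodMk_right s)
      exact intervalIntegral.integral_hasDerivAt_right (c.intervalIntegrable _ _)
        (c.stronglyMeasurableAtFilter _ _) c.continuousAt)
    (intervalIntegral.continuous_parametric_primitive_of_continuous (f := F') cF') cF a a
  -- The parameter and the end point are first treated as independent variables; restricting to the
  -- diagonal by the chain rule adds the two contributions.
  have hd : HasDerivAt (fun s : ℝ => (s, s)) ((1 : ℝ), (1 : ℝ)) a :=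
    (hasDerivAt_id a).prodMk (hasDerivAt_id a)
  have := HasFDerivAt.comp_hasDerivAt (f := fun s : ℝ => (s, s)) (l := fun z : ℝ × ℝ => ∫ q in p..z.2, F z.1 q)
    a key hd
  simpa [Function.comp_def] using this

theorem hasDerivAt_integral_lower {F F' : ℝ → ℝ → ℝ}
    (cF : Continuous fun z : ℝ × ℝ => F z.1 z.2) (cF' : Continuous fun z : ℝ × ℝ => F' z.1 z.2)
    (h : ∀ a q, HasDerivAt (fun s => F s q) (F' a q) a) (p a : ℝ) :
    HasDerivAt (fun s => ∫ q in s..p, F s q) ((∫ q in a..p, F' a q) - F a a) a := by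
  have := (hasDerivAt_integral_upper cF cF' h p a).neg
  rw [neg_add, ← intervalIntegral.integral_symm, ← sub_eq_add_neg] at this
  refine this.congr_of_eventuallyEq (Eventually.of_forall fun s => ?_)
  exact intervalIntegral.integral_symm _ _

/-! ### The kernel -/

/-- The integrand of `ker`. -/
def symb (i l : ℕ) (a b : ℝ) (z : ℂ) : ℂ :=
  (z - 1) ^ i * (z⁻¹ - 1) ^ l * Complex.exp (a * (z - 1) + b * (z⁻¹ - 1))

/-- `∂_a^i ∂_b^l` of the function `exp (-a - b) I₀ (2 √(a b))`, as an integral over the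
unit circle. -/
def ker (i l : ℕ) (a b : ℝ) : ℝ :=
  (2 * Real.pi)⁻¹ * ∫ θ in (0 : ℝ)..2 * Real.pi, (symb i l a b (circleMap 0 1 θ)).re

theorem hasDerivAt_symb_left (i l : ℕ) (a b : ℝ) (z : ℂ) :
    HasDerivAt (fun s : ℝ => (symb i l s b z).re) (symb (i + 1) l a b z).re a := by
  have h1 : HasDerivAt (fun s : ℝ => (s : ℂ) * (z - 1) + b * (z⁻¹ - 1)) (z - 1) a := by
    simpa using ((Complex.ofRealCLM.hasDerivAt (x := a)).mul_const (z - 1)).add_const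
      ((b : ℂ) * (z⁻¹ - 1))
  have h2 := (h1.cexp.const_mul ((z - 1) ^ i * (z⁻¹ - 1) ^ l))
  have h3 := Complex.reCLM.hasFDerivAt.comp_hasDerivAt a h2
  refine h3.congr_deriv ?_
  simp only [symb, Complex.reCLM_apply]
  congr 1
  ring

theorem hasDerivAt_symb_right (i l : ℕ) (a b : ℝ) (z : ℂ) :
    HasDerivAt (fun s : ℝ => (symb i l a s z).re) (symb i (l + 1) a b z).re b := by
  have h1 : HasDerivAt (fun s : ℝ => (a : ℂ) * (z - 1) + s * (z⁻¹ - 1)) (z⁻¹ - 1) b := by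
    simpa using ((Complex.ofRealCLM.hasDerivAt (x := b)).mul_const (z⁻¹ - 1)).const_add
      ((a : ℂ) * (z - 1))
  have h2 := (h1.cexp.const_mul ((z - 1) ^ i * (z⁻¹ - 1) ^ l))
  have h3 := Complex.reCLM.hasFDerivAt.comp_hasDerivAt b h2
  refine h3.congr_deriv ?_
  simp only [symb, Complex.reCLM_apply]
  congr 1
  ring

theorem continuous_symb_circleMap (i l : ℕ) (R : ℝ) (hR : R ≠ 0) :
    Continuous fun z : (ℝ × ℝ) × ℝ => symb i l z.1.1 z.1.2 (circleMap 0 R z.2) := by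
  have h1 : Continuous fun z : (ℝ × ℝ) × ℝ => circleMap 0 R z.2 :=
    (continuous_circleMap 0 R).comp continuous_snd
  have h2 : Continuous fun z : (ℝ × ℝ) × ℝ => (circleMap 0 R z.2)⁻¹ :=
    h1.inv₀ fun z => by simpa using circleMap_ne_center (c := 0) hR (θ := z.2)
  unfold symb
  fun_prop

theorem continuous_symb_circleMap_re (i l : ℕ) :
    Continuous fun z : (ℝ × ℝ) × ℝ => (symb i l z.1.1 z.1.2 (circleMap 0 1 z.2)).re :=
  Complex.continuous_re.comp (continuous_symb_circleMap i l 1 one_ne_zero)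

theorem hasDerivAt_ker_left (i l : ℕ) (a b : ℝ) :
    HasDerivAt (fun s => ker i l s b) (ker (i + 1) l a b) a := by
  have c : ∀ i l, Continuous fun z : ℝ × ℝ => (symb i l z.1 b (circleMap 0 1 z.2)).re := fun i l =>
    (continuous_symb_circleMap_re i l).comp
      (f := fun z : ℝ × ℝ => (((z.1, b), z.2) : (ℝ × ℝ) × ℝ)) (by fun_prop)
  unfold ker
  exact (hasDerivAt_integral_of_continuous
    (F := fun s θ => (symb i l s b (circleMap 0 1 θ)).re)
    (F' := fun s θ => (symb (i + 1) l s b (circleMap 0 1 θ)).re)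
    (c i l) (c (i + 1) l)
    (fun s θ => hasDerivAt_symb_left i l s b _) 0 (2 * Real.pi) a).const_mul _

theorem hasDerivAt_ker_right (i l : ℕ) (a b : ℝ) :
    HasDerivAt (fun s => ker i l a s) (ker i (l + 1) a b) b := by
  have c : ∀ i l, Continuous fun z : ℝ × ℝ => (symb i l a z.1 (circleMap 0 1 z.2)).re := fun i l =>
    (continuous_symb_circleMap_re i l).comp
      (f := fun z : ℝ × ℝ => (((a, z.1), z.2) : (ℝ × ℝ) × ℝ)) (by fun_prop)
  unfold ker
  exact (hasDerivAt_integral_of_continuous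
    (F := fun s θ => (symb i l a s (circleMap 0 1 θ)).re)
    (F' := fun s θ => (symb i (l + 1) a s (circleMap 0 1 θ)).re)
    (c i l) (c i (l + 1))
    (fun s θ => hasDerivAt_symb_right i l a s _) 0 (2 * Real.pi) b).const_mul _

theorem continuous_ker (i l : ℕ) : Continuous fun z : ℝ × ℝ => ker i l z.1 z.2 :=
  continuous_const.mul (intervalIntegral.continuous_parametric_intervalIntegral_of_continuous'
    (f := fun (z : ℝ × ℝ) θ => (symb i l z.1 z.2 (circleMap 0 1 θ)).re)
    (continuous_symb_circleMap_re i l) _ _)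

theorem hasFDerivAt_ker (i l : ℕ) (z : ℝ × ℝ) :
    HasFDerivAt (fun z : ℝ × ℝ => ker i l z.1 z.2)
      (lin2 (ker (i + 1) l z.1 z.2) (ker i (l + 1) z.1 z.2)) z :=
  hasFDerivAt_of_partials (hasDerivAt_ker_left i l) (hasDerivAt_ker_right i l)
    (continuous_ker _ _) (continuous_ker _ _) z.1 z.2

theorem contDiff_lin2 {n : WithTop ℕ∞} {f g : ℝ × ℝ → ℝ} (hf : ContDiff ℝ n f)
    (hg : ContDiff ℝ n g) : ContDiff ℝ n fun z => lin2 (f z) (g z) :=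
  (hf.smul contDiff_const).add (hg.smul contDiff_const)

theorem contDiff_ker (n : ℕ) : ∀ i l : ℕ, ContDiff ℝ n fun z : ℝ × ℝ => ker i l z.1 z.2 := by
  induction n with
  | zero => exact fun i l => contDiff_zero.2 (continuous_ker i l)
  | succ n ih =>
    intro i l
    rw [Nat.cast_succ, contDiff_succ_iff_hasFDerivAt]
    exact ⟨_, contDiff_lin2 (ih _ _) (ih _ _), hasFDerivAt_ker i l⟩

/-- On symbols this is (z-1)(1/z-1) = -(z-1) - (1/z-1). It makes the kernel solve the telegraph
equation, and it later trades a time derivative for two kernel derivatives. -/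
theorem ker_succ_succ (i l : ℕ) (a b : ℝ) :
    ker (i + 1) (l + 1) a b = -ker (i + 1) l a b - ker i (l + 1) a b := by
  have c : ∀ i l, IntervalIntegrable (fun θ => (symb i l a b (circleMap 0 1 θ)).re) volume 0
      (2 * Real.pi) := fun i l =>
    ((continuous_symb_circleMap_re i l).comp
      (Continuous.prodMk_right (a, b))).intervalIntegrable _ _
  have h : ∀ θ, (symb (i + 1) (l + 1) a b (circleMap 0 1 θ)).re =
      -(symb (i + 1) l a b (circleMap 0 1 θ)).re - (symb i (l + 1) a b (circleMap 0 1 θ)).re := by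
    intro θ
    have hz : circleMap 0 1 θ ≠ 0 := circleMap_ne_center (c := 0) one_ne_zero
    rw [← Complex.neg_re, ← Complex.sub_re]
    congr 1
    simp only [symb]
    linear_combination (circleMap 0 1 θ - 1) ^ i * ((circleMap 0 1 θ)⁻¹ - 1) ^ l *
      Complex.exp (a * (circleMap 0 1 θ - 1) + b * ((circleMap 0 1 θ)⁻¹ - 1)) * mul_inv_cancel₀ hz
  unfold ker
  simp_rw [h, ← neg_add']
  rw [intervalIntegral.integral_neg, intervalIntegral.integral_add (c _ _) (c _ _)]
  ring

/-- The kernel may be computed on any circle around the origin. -/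
theorem ker_eq_integral_circleMap (i l : ℕ) (a b : ℝ) {R : ℝ} (hR : 0 < R) :
    ker i l a b =
      (2 * Real.pi)⁻¹ * ∫ θ in (0 : ℝ)..2 * Real.pi, (symb i l a b (circleMap 0 R θ)).re := by
  have hd : ∀ z : ℂ, z ≠ 0 → DifferentiableAt ℂ (symb i l a b) z := by
    intro z hz
    unfold symb
    fun_prop (disch := assumption)
  -- The symbol is holomorphic away from 0, so Cauchy's theorem on the annulus applies; the factor
  -- 1/z turns the contour integral into I times the angular one.
  have aux : ∀ r R : ℝ, 0 < r → r ≤ R →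
      (∮ z in C(0, R), (z - 0)⁻¹ • symb i l a b z) = ∮ z in C(0, r), (z - 0)⁻¹ • symb i l a b z := by
    intro r R hr hrR
    refine Complex.circleIntegral_sub_center_inv_smul_eq_of_differentiable_on_annulus_off_countable
      hr hrR countable_empty ?_ ?_
    · intro z hz
      refine (hd z ?_).continuousAt.continuousWithinAt
      rintro rfl
      exact hz.2 (Metric.mem_ball_self hr)
    · intro z hz
      refine hd z ?_
      rintro rfl
      exact hz.1.2 (Metric.mem_closedBall_self hr.le)
  have aux' : ∀ R : ℝ, 0 < R → (∮ z in C(0, R), (z - 0)⁻¹ • symb i l a b z)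
      = Complex.I * ∫ θ in (0 : ℝ)..2 * Real.pi, symb i l a b (circleMap 0 R θ) := by
    intro R hR
    rw [circleIntegral, ← intervalIntegral.integral_const_mul]
    refine intervalIntegral.integral_congr fun θ _ => ?_
    have hz : circleMap 0 R θ ≠ 0 := circleMap_ne_center (c := 0) hR.ne'
    simp only [deriv_circleMap, sub_zero, smul_eq_mul]
    field_simp
  have eq : (∫ θ in (0 : ℝ)..2 * Real.pi, symb i l a b (circleMap 0 1 θ)) =
      ∫ θ in (0 : ℝ)..2 * Real.pi, symb i l a b (circleMap 0 R θ) := by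
    refine mul_left_cancel₀ Complex.I_ne_zero ?_
    rw [← aux' 1 one_pos, ← aux' R hR]
    rcases le_total R 1 with h | h
    · exact aux _ _ hR h
    · exact (aux _ _ one_pos h).symm
  have re : ∀ R : ℝ, 0 < R → (∫ θ in (0 : ℝ)..2 * Real.pi, (symb i l a b (circleMap 0 R θ)).re) =
      (∫ θ in (0 : ℝ)..2 * Real.pi, symb i l a b (circleMap 0 R θ)).re := by
    intro R hR
    exact Complex.reCLM.intervalIntegral_comp_comm
      (((continuous_symb_circleMap i l R hR.ne').comp
        (Continuous.prodMk_right (a, b))).intervalIntegrable _ _)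
  rw [ker, re 1 one_pos, re R hR, eq]

theorem ker_zero_zero : ker 0 0 0 0 = 1 := by
  have := Real.pi_ne_zero
  simp [ker, symb]
  field_simp

/-- On the unit circle conjugation exchanges z and 1/z, and the real part does not see it. -/
theorem ker_swap (i l : ℕ) (a b : ℝ) : ker i l a b = ker l i b a := by
  have h : ∀ θ : ℝ, (symb i l a b (circleMap 0 1 θ)).re = (symb l i b a (circleMap 0 1 θ)).re := by
    intro θ
    have hz : (circleMap 0 1 θ)⁻¹ = (starRingEnd ℂ) (circleMap 0 1 θ) := by
      rw [Complex.inv_def]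
      simp [Complex.normSq_eq_norm_sq]
    have : symb i l a b (circleMap 0 1 θ) = (starRingEnd ℂ) (symb l i b a (circleMap 0 1 θ)) := by
      simp only [symb, hz, map_mul, map_pow, map_sub, map_one, ← Complex.exp_conj, map_add,
        Complex.conj_conj, Complex.conj_ofReal]
      rw [mul_comm (_ ^ i), add_comm]
    rw [this, Complex.conj_re]
  simp only [ker, h]

/-- The sum of the two symbols is z exp(a(z-1)), whose angular mean is a contour integral of an
entire function, hence zero. This amounts to k(a, 0) = exp(-a), the characteristic condition on the
Riemann function. -/
theorem ker_one_zero_right (a : ℝ) : ker 1 0 a 0 = -ker 0 0 a 0 := by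
  have c : ∀ i l, IntervalIntegrable (fun θ => (symb i l a 0 (circleMap 0 1 θ)).re) volume 0
      (2 * Real.pi) := fun i l =>
    ((continuous_symb_circleMap_re i l).comp
      (Continuous.prodMk_right (a, 0))).intervalIntegrable _ _
  have h0 : (∮ z in C(0, 1), Complex.exp (a * (z - 1))) = 0 := by
    refine Complex.circleIntegral_eq_zero_of_differentiable_on_off_countable zero_le_one
      countable_empty ?_ ?_
    · fun_prop
    · intro z _
      fun_prop
  have h1 : (∫ θ in (0 : ℝ)..2 * Real.pi,
      ((symb 1 0 a 0 (circleMap 0 1 θ)).re + (symb 0 0 a 0 (circleMap 0 1 θ)).re)) = 0 := by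
    have e : ∀ θ : ℝ, (symb 1 0 a 0 (circleMap 0 1 θ)).re + (symb 0 0 a 0 (circleMap 0 1 θ)).re =
        (-Complex.I * (deriv (circleMap 0 1) θ • Complex.exp (a * (circleMap 0 1 θ - 1)))).re := by
      intro θ
      rw [← Complex.add_re]
      congr 1
      simp only [symb, deriv_circleMap, smul_eq_mul]
      simp
      ring_nf
      simp
    simp_rw [e]
    have := Complex.reCLM.intervalIntegral_comp_comm (μ := volume) (a := 0) (b := 2 * Real.pi)
      (f := fun θ => -Complex.I * (deriv (circleMap 0 1) θ •
        Complex.exp (a * (circleMap 0 1 θ - 1)))) ?_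
    · simp only [Complex.reCLM_apply] at this
      rw [this, intervalIntegral.integral_const_mul]
      rw [circleIntegral] at h0
      rw [h0]
      simp
    · refine Continuous.intervalIntegrable ?_ _ _
      simp only [deriv_circleMap]
      fun_prop
  rw [intervalIntegral.integral_add (c _ _) (c _ _)] at h1
  unfold ker
  linear_combination (2 * Real.pi)⁻¹ * h1

theorem ker_zero_one_left (b : ℝ) : ker 0 1 0 b = -ker 0 0 0 b := by
  rw [ker_swap, ker_one_zero_right, ker_swap]

/-! ### Gaussian bounds for the kernel -/

theorem norm_exp_mul_exp_sub_one_le {σ : ℝ} (hσ : |σ| ≤ 1 / 2) (θ : ℝ) :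
    ‖(Real.exp σ : ℂ) * Complex.exp (θ * Complex.I) - 1‖ ≤ 3 * (|σ| + |θ|) := by
  have h1 : |Real.exp σ - 1| ≤ 2 * |σ| := Real.abs_exp_sub_one_le (by linarith)
  have h2 : Real.exp σ ≤ 2 := by linarith [(abs_le.1 h1).2]
  have h3 : ‖Complex.exp (θ * Complex.I) - 1‖ ≤ |θ| := by
    rw [mul_comm]
    exact Real.norm_exp_I_mul_ofReal_sub_one_le
  have h4 : (Real.exp σ : ℂ) * Complex.exp (θ * Complex.I) - 1 =
      (Real.exp σ : ℂ) * (Complex.exp (θ * Complex.I) - 1) + ((Real.exp σ - 1 : ℝ) : ℂ) := by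
    push_cast
    ring
  rw [h4]
  refine (norm_add_le _ _).trans ?_
  rw [norm_mul, Complex.norm_real, Complex.norm_real, Real.norm_eq_abs, Real.norm_eq_abs,
    abs_of_pos (Real.exp_pos σ)]
  have := mul_le_mul h2 h3 (norm_nonneg _) zero_le_two
  linarith [abs_nonneg σ, abs_nonneg θ]

/-- Real part of the exponent at z = exp(σ + iθ), from exp s ≤ 1 + s + s², cos θ ≤ 1 - 2θ²/π² and
exp s ≥ 1/2. The last bound is why |σ| ≤ 1/2 is asked for. -/
theorem re_exponent_le {a b σ θ : ℝ} (ha : 0 ≤ a) (hb : 0 ≤ b) (hσ : |σ| ≤ 1 / 2)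
    (hθ : |θ| ≤ Real.pi) :
    a * (Real.exp σ * Real.cos θ - 1) + b * (Real.exp (-σ) * Real.cos θ - 1) ≤
      (a - b) * σ + (a + b) * σ ^ 2 - (a + b) * (θ ^ 2 / Real.pi ^ 2) := by
  have aux : ∀ s : ℝ, |s| ≤ 1 / 2 →
      Real.exp s * Real.cos θ - 1 ≤ s + s ^ 2 - θ ^ 2 / Real.pi ^ 2 := by
    intro s hs
    have h1 := (abs_le.1 (Real.abs_exp_sub_one_sub_id_le (x := s) (by linarith))).2
    have h2 : (1 : ℝ) / 2 ≤ Real.exp s := by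
      linarith [Real.add_one_le_exp s, (abs_le.1 hs).1]
    have h3 := Real.cos_le_one_sub_mul_cos_sq hθ
    have h4 : Real.exp s * Real.cos θ ≤ Real.exp s * (1 - 2 * (θ ^ 2 / Real.pi ^ 2)) := by
      refine mul_le_mul_of_nonneg_left (h3.trans_eq ?_) (Real.exp_pos s).le
      ring
    have h5 := mul_le_mul_of_nonneg_right h2 (by positivity : 0 ≤ θ ^ 2 / Real.pi ^ 2)
    linarith
  have h1 := mul_le_mul_of_nonneg_left (aux σ hσ) ha
  have h2 := mul_le_mul_of_nonneg_left (aux (-σ) (by rwa [abs_neg])) hb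
  linarith

theorem norm_symb_le (i l : ℕ) {a b σ θ : ℝ} (ha : 0 ≤ a) (hb : 0 ≤ b) (hσ : |σ| ≤ 1 / 2)
    (hθ : |θ| ≤ Real.pi) :
    ‖symb i l a b (circleMap 0 (Real.exp σ) θ)‖ ≤ (3 * (|σ| + |θ|)) ^ (i + l) *
      Real.exp ((a - b) * σ + (a + b) * σ ^ 2 - (a + b) * (θ ^ 2 / Real.pi ^ 2)) := by
  have hz : circleMap 0 (Real.exp σ) θ = (Real.exp σ : ℂ) * Complex.exp (θ * Complex.I) := by
    simp [circleMap]
  have hz' : (circleMap 0 (Real.exp σ) θ)⁻¹ =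
      (Real.exp (-σ) : ℂ) * Complex.exp ((-θ : ℝ) * Complex.I) := by
    rw [hz, mul_inv, ← Complex.exp_neg, Complex.ofReal_exp, Complex.ofReal_exp, ← Complex.exp_neg]
    push_cast
    ring_nf
  have h1 := norm_exp_mul_exp_sub_one_le hσ θ
  have h2 := norm_exp_mul_exp_sub_one_le (σ := -σ) (by rwa [abs_neg]) (-θ)
  rw [abs_neg, abs_neg] at h2
  rw [symb, norm_mul, norm_mul, norm_pow, norm_pow, Complex.norm_exp, hz', hz, pow_add]
  have h3 : ((a : ℂ) * ((Real.exp σ : ℂ) * Complex.exp (θ * Complex.I) - 1) +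
      b * ((Real.exp (-σ) : ℂ) * Complex.exp ((-θ : ℝ) * Complex.I) - 1)).re =
      a * (Real.exp σ * Real.cos θ - 1) + b * (Real.exp (-σ) * Real.cos θ - 1) := by
    simp only [Complex.add_re, Complex.re_ofReal_mul, Complex.sub_re, Complex.exp_ofReal_mul_I_re,
      Complex.one_re, Real.cos_neg]
  rw [h3]
  gcongr
  exact re_exponent_le ha hb hσ hθ

theorem pow_mul_exp_neg_sq_le (n : ℕ) {X κ : ℝ} (hX : 0 ≤ X) (hκ : 0 < κ) :
    X ^ n * Real.exp (-(κ * X ^ 2)) ≤ n.factorial * Real.exp (1 / (4 * κ)) := by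
  have h1 : X ^ n ≤ n.factorial * Real.exp X := by
    have := Real.pow_div_factorial_le_exp X hX n
    rwa [div_le_iff₀' (by positivity)] at this
  have h2 : X - κ * X ^ 2 ≤ 1 / (4 * κ) := by
    rw [le_div_iff₀ (by positivity)]
    nlinarith [sq_nonneg (2 * κ * X - 1)]
  calc X ^ n * Real.exp (-(κ * X ^ 2)) ≤ n.factorial * Real.exp X * Real.exp (-(κ * X ^ 2)) := by
        gcongr
    _ = n.factorial * Real.exp (X - κ * X ^ 2) := by
        rw [mul_assoc, ← Real.exp_add, sub_eq_add_neg]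
    _ ≤ _ := by gcongr

/-- With S = 1 + a + b, the radius exp σ uses the minimizer σ = -(a-b)/(2S) of (a-b)σ + Sσ². The 1
in S keeps |σ| ≤ 1/2 and avoids a singularity at a = b = 0. -/
theorem norm_symb_le_gaussian (i l : ℕ) {a b θ : ℝ} (ha : 0 ≤ a) (hb : 0 ≤ b)
    (hθ : |θ| ≤ Real.pi) :
    ‖symb i l a b (circleMap 0 (Real.exp (-(a - b) / (2 * (1 + a + b)))) θ)‖ ≤
      3 ^ (i + l) * ((i + l).factorial * Real.exp (1 / (4 * (1 / (4 * Real.pi ^ 2))))) * Real.exp 1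
        / √(1 + a + b) ^ (i + l) * Real.exp (-((a - b) ^ 2 / (8 * (1 + a + b)))) *
        Real.exp (-((1 + a + b) / (2 * Real.pi ^ 2)) * θ ^ 2) := by
  set S := 1 + a + b with hS
  have hS0 : 0 < S := by positivity
  set σ := -(a - b) / (2 * S) with hσdef
  have hσS : a - b = -(2 * S * σ) := by rw [hσdef]; field_simp
  have hσ : |σ| ≤ 1 / 2 := by
    rw [hσdef, abs_div, abs_neg, abs_of_pos (by positivity : 0 < 2 * S), div_le_iff₀ (by positivity)]
    rw [abs_le]
    constructor <;> linarith
  refine (norm_symb_le i l ha hb hσ hθ).trans ?_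
  set N := i + l
  have hr : √S ^ 2 = S := Real.sq_sqrt hS0.le
  have hr0 : 0 < √S := Real.sqrt_pos.2 hS0
  have hpi := Real.pi_pos
  have hpi3 := Real.pi_gt_three
  have hY := pow_mul_exp_neg_sq_le N (X := √S * (|σ| + |θ|)) (κ := 1 / (4 * Real.pi ^ 2))
    (by positivity) (by positivity)
  set E := (N.factorial : ℝ) * Real.exp (1 / (4 * (1 / (4 * Real.pi ^ 2))))
  -- Part of the decay in σ and θ is set aside to absorb the polynomial factor, written as a power
  -- of √S(|σ|+|θ|); the rest is the final Gaussian. The + 1 pays for replacing a + b by S, since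
  -- θ²/π² ≤ 1.
  have hexp : (a - b) * σ + (a + b) * σ ^ 2 - (a + b) * (θ ^ 2 / Real.pi ^ 2) ≤
      -(1 / (4 * Real.pi ^ 2) * (√S * (|σ| + |θ|)) ^ 2) + 1 + -((a - b) ^ 2 / (8 * S)) +
        -(S / (2 * Real.pi ^ 2)) * θ ^ 2 := by
    have e1 : (a - b) ^ 2 / (8 * S) = S * σ ^ 2 / 2 := by rw [hσS]; field_simp; ring
    have e2 : a + b = S - 1 := by rw [hS]; ring
    have e3 : θ ^ 2 / Real.pi ^ 2 ≤ 1 := by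
      rw [div_le_one (by positivity)]
      exact sq_le_sq' (by linarith [(abs_le.1 hθ).1]) (abs_le.1 hθ).2
    have e4 : (|σ| + |θ|) ^ 2 ≤ 2 * (σ ^ 2 + θ ^ 2) := by
      rw [← sq_abs σ, ← sq_abs θ]
      nlinarith [sq_nonneg (|σ| - |θ|)]
    have e5 : S * σ ^ 2 / Real.pi ^ 2 ≤ S * σ ^ 2 := div_le_self (by positivity) (by nlinarith)
    have e6 : 1 / (4 * Real.pi ^ 2) * (√S * (|σ| + |θ|)) ^ 2 ≤
        S * σ ^ 2 / Real.pi ^ 2 / 2 + S * (θ ^ 2 / Real.pi ^ 2) / 2 := by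
      rw [mul_pow, hr]
      calc 1 / (4 * Real.pi ^ 2) * (S * (|σ| + |θ|) ^ 2)
          ≤ 1 / (4 * Real.pi ^ 2) * (S * (2 * (σ ^ 2 + θ ^ 2))) := by gcongr
        _ = _ := by field_simp; ring
    have e7 : -(S / (2 * Real.pi ^ 2)) * θ ^ 2 = -(S * (θ ^ 2 / Real.pi ^ 2) / 2) := by
      field_simp
    rw [e1, e2, e7, hσS]
    nlinarith [sq_nonneg σ]
  calc (3 * (|σ| + |θ|)) ^ N * Real.exp _
      ≤ (3 * (|σ| + |θ|)) ^ N * Real.exp (-(1 / (4 * Real.pi ^ 2) * (√S * (|σ| + |θ|)) ^ 2) + 1 +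
          -((a - b) ^ 2 / (8 * S)) + -(S / (2 * Real.pi ^ 2)) * θ ^ 2) := by gcongr
    _ = 3 ^ N * ((√S * (|σ| + |θ|)) ^ N *
          Real.exp (-(1 / (4 * Real.pi ^ 2) * (√S * (|σ| + |θ|)) ^ 2))) * Real.exp 1 / √S ^ N *
          Real.exp (-((a - b) ^ 2 / (8 * S))) * Real.exp (-(S / (2 * Real.pi ^ 2)) * θ ^ 2) := by
        rw [Real.exp_add, Real.exp_add, Real.exp_add, mul_pow, mul_pow _ _ N]
        field_simp
    _ ≤ _ := by gcongr

/-- The i + l symbol factors each give S^(-1/2), and the Gaussian integral in θ gives one more,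
hence the exponent i + l + 1. -/
theorem abs_ker_le (i l : ℕ) : ∃ C : ℝ, 0 < C ∧ ∀ a b : ℝ, 0 ≤ a → 0 ≤ b →
    |ker i l a b| ≤ C / √(1 + a + b) ^ (i + l + 1) *
      Real.exp (-((a - b) ^ 2 / (8 * (1 + a + b)))) := by
  have hpi := Real.pi_pos
  obtain ⟨D, hD0, hD⟩ : ∃ D : ℝ, 0 < D ∧ ∀ a b θ : ℝ, 0 ≤ a → 0 ≤ b → |θ| ≤ Real.pi →
      ‖symb i l a b (circleMap 0 (Real.exp (-(a - b) / (2 * (1 + a + b)))) θ)‖ ≤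
      D / √(1 + a + b) ^ (i + l) * Real.exp (-((a - b) ^ 2 / (8 * (1 + a + b)))) *
        Real.exp (-((1 + a + b) / (2 * Real.pi ^ 2)) * θ ^ 2) :=
    ⟨_, by positivity, fun a b θ ha hb hθ => norm_symb_le_gaussian i l ha hb hθ⟩
  refine ⟨(2 * Real.pi)⁻¹ * D * √(Real.pi * (2 * Real.pi ^ 2)), by positivity,
    fun a b ha hb => ?_⟩
  set S := 1 + a + b with hS
  have hS0 : 0 < S := by positivity
  set R := Real.exp (-(a - b) / (2 * S))
  set A := D / √S ^ (i + l) * Real.exp (-((a - b) ^ 2 / (8 * S)))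
  have hA : 0 ≤ A := by positivity
  set k := S / (2 * Real.pi ^ 2)
  have hk : 0 < k := by positivity
  -- Periodicity recentres the angle on [-π, π], where the quadratic bound on the cosine holds.
  have per : Function.Periodic (fun θ => (symb i l a b (circleMap 0 R θ)).re) (2 * Real.pi) := by
    intro θ
    simp only [periodic_circleMap 0 R θ]
  have h1 : (∫ θ in (0 : ℝ)..2 * Real.pi, (symb i l a b (circleMap 0 R θ)).re) =
      ∫ θ in -Real.pi..Real.pi, (symb i l a b (circleMap 0 R θ)).re := by
    have := per.intervalIntegral_add_eq 0 (-Real.pi)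
    rw [zero_add] at this
    rw [this]
    congr 1
    ring
  have hint : Integrable fun θ : ℝ => A * Real.exp (-k * θ ^ 2) :=
    (integrable_exp_neg_mul_sq hk).const_mul A
  have h2 : |∫ θ in -Real.pi..Real.pi, (symb i l a b (circleMap 0 R θ)).re| ≤
      ∫ θ in -Real.pi..Real.pi, A * Real.exp (-k * θ ^ 2) := by
    rw [← Real.norm_eq_abs]
    refine intervalIntegral.norm_integral_le_of_norm_le (by linarith) ?_
      hint.intervalIntegrable
    refine Eventually.of_forall fun θ hθ => ?_
    exact (Complex.abs_re_le_norm _).trans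
      (hD a b θ ha hb (abs_le.2 ⟨hθ.1.le, hθ.2⟩))
  have h3 : (∫ θ in -Real.pi..Real.pi, A * Real.exp (-k * θ ^ 2)) ≤ A * √(Real.pi / k) := by
    rw [intervalIntegral.integral_of_le (by linarith), ← integral_gaussian k,
      ← integral_const_mul]
    exact setIntegral_le_integral hint (Eventually.of_forall fun θ => by positivity)
  have h4 : √(Real.pi / k) = √(Real.pi * (2 * Real.pi ^ 2)) / √S := by
    rw [← Real.sqrt_div' _ hS0.le]
    congr 1
    simp only [k]
    field_simp
  rw [ker_eq_integral_circleMap i l a b (Real.exp_pos _), h1, abs_mul,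
    abs_of_pos (by positivity : 0 < (2 * Real.pi)⁻¹)]
  calc (2 * Real.pi)⁻¹ * |∫ θ in -Real.pi..Real.pi, (symb i l a b (circleMap 0 R θ)).re|
      ≤ (2 * Real.pi)⁻¹ * (A * √(Real.pi / k)) := by gcongr; exact h2.trans h3
    _ = _ := by
      rw [h4, pow_succ]
      simp only [A]
      field_simp
      ring

/-! ### Integral and boundary operators in characteristic coordinates -/

/-- The integral operator with kernel `ker i l` between the two characteristics. -/
def kerInt (μ ν : ℝ) (i l : ℕ) (g : ℝ → ℝ) (ξ η : ℝ) : ℝ :=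
  ∫ q in ξ..η, ker i l (μ * (η - q)) (ν * (q - ξ)) * g q

/-- The trace term on the first characteristic. -/
def traceL (μ : ℝ) (i l m : ℕ) (g : ℝ → ℝ) (ξ η : ℝ) : ℝ :=
  ker i l (μ * (η - ξ)) 0 * iteratedDeriv m g ξ

/-- The trace term on the second characteristic. -/
def traceR (ν : ℝ) (i l m : ℕ) (g : ℝ → ℝ) (ξ η : ℝ) : ℝ :=
  ker i l 0 (ν * (η - ξ)) * iteratedDeriv m g η

section

variable {μ ν : ℝ} {g : ℝ → ℝ}

theorem continuous_ker_comp {X : Type*} [TopologicalSpace X] (i l : ℕ) {a b : X → ℝ}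
    (ha : Continuous a) (hb : Continuous b) : Continuous fun x => ker i l (a x) (b x) :=
  Continuous.comp (g := fun z : ℝ × ℝ => ker i l z.1 z.2) (f := fun x => (a x, b x))
    (continuous_ker i l) (ha.prodMk hb)

theorem contDiff_ker_comp {n : ℕ} (i l : ℕ) {a b : ℝ × ℝ → ℝ}
    (ha : ContDiff ℝ n a) (hb : ContDiff ℝ n b) : ContDiff ℝ n fun x => ker i l (a x) (b x) :=
  ContDiff.comp (g := fun z : ℝ × ℝ => ker i l z.1 z.2) (f := fun x => (a x, b x))
    (contDiff_ker n i l) (ha.prodMk hb)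

theorem hasDerivAt_kerInt_right (hg : Continuous g) (i l : ℕ) (ξ η : ℝ) :
    HasDerivAt (fun s => kerInt μ ν i l g ξ s)
      (μ * kerInt μ ν (i + 1) l g ξ η + traceR ν i l 0 g ξ η) η := by
  have key := hasDerivAt_integral_upper
    (F := fun s q => ker i l (μ * (s - q)) (ν * (q - ξ)) * g q)
    (F' := fun s q => μ * (ker (i + 1) l (μ * (s - q)) (ν * (q - ξ)) * g q))
    ((continuous_ker_comp i l (by fun_prop) (by fun_prop)).mul (by fun_prop))
    (continuous_const.mul
      ((continuous_ker_comp (i + 1) l (by fun_prop) (by fun_prop)).mul (by fun_prop)))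
    (fun s q => by
      have h1 : HasDerivAt (fun s => μ * (s - q)) μ s := by
        simpa using ((hasDerivAt_id s).sub_const q).const_mul μ
      have := ((hasDerivAt_ker_left i l (μ * (s - q)) (ν * (q - ξ))).comp s h1).mul_const (g q)
      refine this.congr_deriv ?_
      ring) ξ η
  refine key.congr_deriv ?_
  rw [intervalIntegral.integral_const_mul]
  simp [kerInt, traceR]

theorem hasDerivAt_kerInt_left (hg : Continuous g) (i l : ℕ) (ξ η : ℝ) :
    HasDerivAt (fun s => kerInt μ ν i l g s η)
      (-(ν * kerInt μ ν i (l + 1) g ξ η + traceL μ i l 0 g ξ η)) ξ := by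
  have key := hasDerivAt_integral_lower
    (F := fun s q => ker i l (μ * (η - q)) (ν * (q - s)) * g q)
    (F' := fun s q => -ν * (ker i (l + 1) (μ * (η - q)) (ν * (q - s)) * g q))
    ((continuous_ker_comp i l (by fun_prop) (by fun_prop)).mul (by fun_prop))
    (continuous_const.mul
      ((continuous_ker_comp i (l + 1) (by fun_prop) (by fun_prop)).mul (by fun_prop)))
    (fun s q => by
      have h1 : HasDerivAt (fun s => ν * (q - s)) (-ν) s := by
        simpa using ((hasDerivAt_id s).const_sub q).const_mul ν
      have := ((hasDerivAt_ker_right i l (μ * (η - q)) (ν * (q - s))).comp s h1).mul_const (g q)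
      refine this.congr_deriv ?_
      ring) η ξ
  refine key.congr_deriv ?_
  rw [intervalIntegral.integral_const_mul]
  simp [kerInt, traceL]
  ring

theorem continuous_kerInt (hg : Continuous g) (i l : ℕ) :
    Continuous fun z : ℝ × ℝ => kerInt μ ν i l g z.1 z.2 := by
  have c : Continuous fun p : (ℝ × ℝ) × ℝ =>
      ker i l (μ * (p.1.2 - p.2)) (ν * (p.2 - p.1.1)) * g p.2 :=
    (continuous_ker_comp i l (by fun_prop) (by fun_prop)).mul (by fun_prop)
  -- Both end points move, so the integral is split at the fixed point 0.
  have h : ∀ s : ℝ × ℝ → ℝ, Continuous s → Continuous fun z : ℝ × ℝ =>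
      ∫ q in (0 : ℝ)..s z, ker i l (μ * (z.2 - q)) (ν * (q - z.1)) * g q := fun s hs =>
    intervalIntegral.continuous_parametric_intervalIntegral_of_continuous
      (f := fun (z : ℝ × ℝ) q => ker i l (μ * (z.2 - q)) (ν * (q - z.1)) * g q) c hs
  refine ((h Prod.snd continuous_snd).sub (h Prod.fst continuous_fst)).congr fun z => ?_
  have ci : ∀ a b : ℝ, IntervalIntegrable
      (fun q => ker i l (μ * (z.2 - q)) (ν * (q - z.1)) * g q) volume a b := fun a b =>
    (c.comp (Continuous.prodMk_right z)).intervalIntegrable a b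
  exact intervalIntegral.integral_interval_sub_left (ci _ _) (ci _ _)

theorem continuous_traceL {m : ℕ} (hg : ContDiff ℝ m g) (i l : ℕ) :
    Continuous fun z : ℝ × ℝ => traceL μ i l m g z.1 z.2 :=
  (continuous_ker_comp i l (by fun_prop) (by fun_prop)).mul
    ((hg.continuous_iteratedDeriv' m).comp continuous_fst)

theorem continuous_traceR {m : ℕ} (hg : ContDiff ℝ m g) (i l : ℕ) :
    Continuous fun z : ℝ × ℝ => traceR ν i l m g z.1 z.2 :=
  (continuous_ker_comp i l (by fun_prop) (by fun_prop)).mul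
    ((hg.continuous_iteratedDeriv' m).comp continuous_snd)

theorem hasFDerivAt_kerInt (hg : Continuous g) (i l : ℕ) (z : ℝ × ℝ) :
    HasFDerivAt (fun z : ℝ × ℝ => kerInt μ ν i l g z.1 z.2)
      (lin2 (-(ν * kerInt μ ν i (l + 1) g z.1 z.2 + traceL μ i l 0 g z.1 z.2))
        (μ * kerInt μ ν (i + 1) l g z.1 z.2 + traceR ν i l 0 g z.1 z.2)) z :=
  hasFDerivAt_of_partials (hasDerivAt_kerInt_left hg i l) (hasDerivAt_kerInt_right hg i l)
    ((continuous_const.mul (continuous_kerInt hg _ _)).add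
      (continuous_traceL (m := 0) (by simpa [contDiff_zero] using hg) _ _)).neg
    ((continuous_const.mul (continuous_kerInt hg _ _)).add
      (continuous_traceR (m := 0) (by simpa [contDiff_zero] using hg) _ _)) z.1 z.2

theorem hasDerivAt_iteratedDeriv {m : ℕ} (hg : ContDiff ℝ (m + 1 : ℕ) g) (x : ℝ) :
    HasDerivAt (iteratedDeriv m g) (iteratedDeriv (m + 1) g x) x := by
  rw [iteratedDeriv_succ]
  exact ((hg.differentiable_iteratedDeriv m (by exact_mod_cast Nat.lt_succ_self m)) x).hasDerivAt

theorem hasFDerivAt_traceL {m : ℕ} (hg : ContDiff ℝ (m + 1 : ℕ) g) (i l : ℕ) (z : ℝ × ℝ) :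
    HasFDerivAt (fun z : ℝ × ℝ => traceL μ i l m g z.1 z.2)
      (lin2 (-(μ * traceL μ (i + 1) l m g z.1 z.2) + traceL μ i l (m + 1) g z.1 z.2)
        (μ * traceL μ (i + 1) l m g z.1 z.2)) z := by
  have h1 : HasFDerivAt (fun z : ℝ × ℝ => μ * (z.2 - z.1)) (lin2 (-μ) μ) z := by
    refine ((hasFDerivAt_snd.sub hasFDerivAt_fst).const_mul μ).congr_fderiv ?_
    ext <;> simp [lin2]
  have h2 := (hasDerivAt_ker_left i l (μ * (z.2 - z.1)) 0).comp_hasFDerivAt z h1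
  have h3 := (hasDerivAt_iteratedDeriv hg z.1).comp_hasFDerivAt z
    (hasFDerivAt_fst (𝕜 := ℝ) (E := ℝ) (F := ℝ))
  refine (h2.mul h3).congr_fderiv ?_
  ext <;> simp [lin2, traceL] <;> ring

theorem hasFDerivAt_traceR {m : ℕ} (hg : ContDiff ℝ (m + 1 : ℕ) g) (i l : ℕ) (z : ℝ × ℝ) :
    HasFDerivAt (fun z : ℝ × ℝ => traceR ν i l m g z.1 z.2)
      (lin2 (-(ν * traceR ν i (l + 1) m g z.1 z.2))
        (ν * traceR ν i (l + 1) m g z.1 z.2 + traceR ν i l (m + 1) g z.1 z.2)) z := by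
  have h1 : HasFDerivAt (fun z : ℝ × ℝ => ν * (z.2 - z.1)) (lin2 (-ν) ν) z := by
    refine ((hasFDerivAt_snd.sub hasFDerivAt_fst).const_mul ν).congr_fderiv ?_
    ext <;> simp [lin2]
  have h2 := (hasDerivAt_ker_right i l 0 (ν * (z.2 - z.1))).comp_hasFDerivAt z h1
  have h3 := (hasDerivAt_iteratedDeriv hg z.2).comp_hasFDerivAt z
    (hasFDerivAt_snd (𝕜 := ℝ) (E := ℝ) (F := ℝ))
  refine (h2.mul h3).congr_fderiv ?_
  ext <;> simp [lin2, traceR] <;> ring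

theorem contDiff_traceL {n : ℕ} (hg : ContDiff ℝ n g) (i l : ℕ) :
    ContDiff ℝ n fun z : ℝ × ℝ => traceL μ i l 0 g z.1 z.2 := by
  simp only [traceL, iteratedDeriv_zero]
  exact (contDiff_ker_comp i l (by fun_prop) (by fun_prop)).mul (hg.comp contDiff_fst)

theorem contDiff_traceR {n : ℕ} (hg : ContDiff ℝ n g) (i l : ℕ) :
    ContDiff ℝ n fun z : ℝ × ℝ => traceR ν i l 0 g z.1 z.2 := by
  simp only [traceR, iteratedDeriv_zero]
  exact (contDiff_ker_comp i l (by fun_prop) (by fun_prop)).mul (hg.comp contDiff_snd)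

theorem contDiff_kerInt {n : ℕ} (hg : ContDiff ℝ n g) :
    ∀ i l : ℕ, ContDiff ℝ n fun z : ℝ × ℝ => kerInt μ ν i l g z.1 z.2 := by
  induction n with
  | zero => exact fun i l => contDiff_zero.2 (continuous_kerInt hg.continuous i l)
  | succ n ih =>
    intro i l
    have hg' : ContDiff ℝ n g := hg.of_le (by exact_mod_cast Nat.le_succ n)
    rw [Nat.cast_succ, contDiff_succ_iff_hasFDerivAt]
    exact ⟨_, contDiff_lin2
      ((contDiff_const.mul (ih hg' i (l + 1))).add (contDiff_traceL hg' i l)).neg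
      ((contDiff_const.mul (ih hg' (i + 1) l)).add (contDiff_traceR hg' i l)),
      hasFDerivAt_kerInt hg.continuous i l⟩

theorem kerInt_succ_succ (hg : Continuous g) (i l : ℕ) (ξ η : ℝ) :
    kerInt μ ν (i + 1) (l + 1) g ξ η =
      -kerInt μ ν (i + 1) l g ξ η - kerInt μ ν i (l + 1) g ξ η := by
  have c : ∀ i l, IntervalIntegrable
      (fun q => ker i l (μ * (η - q)) (ν * (q - ξ)) * g q) volume ξ η := fun i l =>
    ((continuous_ker_comp i l (by fun_prop) (by fun_prop)).mul hg).intervalIntegrable _ _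
  have e : ∀ q, ker (i + 1) (l + 1) (μ * (η - q)) (ν * (q - ξ)) * g q =
      -(ker (i + 1) l (μ * (η - q)) (ν * (q - ξ)) * g q +
        ker i (l + 1) (μ * (η - q)) (ν * (q - ξ)) * g q) := by
    intro q
    rw [ker_succ_succ]
    ring
  unfold kerInt
  simp_rw [e]
  rw [intervalIntegral.integral_neg, intervalIntegral.integral_add (c _ _) (c _ _)]
  ring

end

/-! ### The class of operators stable under differentiation -/

/-- Linear combinations of integral operators whose kernel carries at least `N` derivatives and of
trace terms with at most `M` derivatives of the data. -/
inductive Rep (μ ν : ℝ) (N M : ℕ) : ((ℝ → ℝ) → ℝ → ℝ → ℝ) → Prop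
  | kerInt (i l : ℕ) (h : N ≤ i + l) : Rep μ ν N M (kerInt μ ν i l)
  | traceL (i l m : ℕ) (h : m ≤ M) : Rep μ ν N M (traceL μ i l m)
  | traceR (i l m : ℕ) (h : m ≤ M) : Rep μ ν N M (traceR ν i l m)
  | add {S T : (ℝ → ℝ) → ℝ → ℝ → ℝ} (hS : Rep μ ν N M S) (hT : Rep μ ν N M T) :
      Rep μ ν N M fun g ξ η => S g ξ η + T g ξ η
  | smul {T : (ℝ → ℝ) → ℝ → ℝ → ℝ} (c : ℝ) (hT : Rep μ ν N M T) :
      Rep μ ν N M fun g ξ η => c * T g ξ η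

theorem hasDerivAt_space {f : ℝ → ℝ → ℝ} {p q lam₁ lam₂ x t : ℝ}
    (h : HasFDerivAt (fun z : ℝ × ℝ => f z.1 z.2) (lin2 p q) (x - lam₁ * t, x - lam₂ * t)) :
    HasDerivAt (fun y => f (y - lam₁ * t) (y - lam₂ * t)) (p + q) x := by
  have hd : HasDerivAt (fun y : ℝ => (y - lam₁ * t, y - lam₂ * t)) ((1 : ℝ), (1 : ℝ)) x :=
    ((hasDerivAt_id x).sub_const _).prodMk ((hasDerivAt_id x).sub_const _)
  have := HasFDerivAt.comp_hasDerivAt (f := fun y : ℝ => (y - lam₁ * t, y - lam₂ * t))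
    (l := fun z : ℝ × ℝ => f z.1 z.2) x h hd
  simpa [Function.comp_def] using this

theorem hasDerivAt_time {f : ℝ → ℝ → ℝ} {p q lam₁ lam₂ x t : ℝ}
    (h : HasFDerivAt (fun z : ℝ × ℝ => f z.1 z.2) (lin2 p q) (x - lam₁ * t, x - lam₂ * t)) :
    HasDerivAt (fun s => f (x - lam₁ * s) (x - lam₂ * s)) (-lam₁ * p + -lam₂ * q) t := by
  have hd : HasDerivAt (fun s : ℝ => (x - lam₁ * s, x - lam₂ * s)) (-lam₁, -lam₂) t := by
    have e : ∀ c : ℝ, HasDerivAt (fun s : ℝ => x - c * s) (-c) t := fun c => by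
      simpa using ((hasDerivAt_id t).const_mul c).const_sub x
    exact (e _).prodMk (e _)
  have := HasFDerivAt.comp_hasDerivAt (f := fun s : ℝ => (x - lam₁ * s, x - lam₂ * s))
    (l := fun z : ℝ × ℝ => f z.1 z.2) t h hd
  simpa [Function.comp_def, mul_comm] using this

/-- ∂_x = ∂_ξ + ∂_η falls on the kernel, never on the data inside the integral; only traces
differentiate the data. -/
theorem Rep.space_deriv {μ ν : ℝ} {N M : ℕ} {T : (ℝ → ℝ) → ℝ → ℝ → ℝ} (lam₁ lam₂ : ℝ)
    (hT : Rep μ ν N M T) :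
    ∃ T', Rep μ ν (N + 1) (M + 1) T' ∧ ∀ g : ℝ → ℝ, ContDiff ℝ (M + 1 : ℕ) g → ∀ x t : ℝ,
      HasDerivAt (fun y => T g (y - lam₁ * t) (y - lam₂ * t))
        (T' g (x - lam₁ * t) (x - lam₂ * t)) x := by
  induction hT with
  | kerInt i l h =>
    refine ⟨_, ((Rep.kerInt i (l + 1) (by omega)).smul (-ν)).add
      (((Rep.traceL i l 0 (by omega)).smul (-1)).add
      (((Rep.kerInt (i + 1) l (by omega)).smul μ).add (Rep.traceR i l 0 (by omega)))),
      fun g hg x t => ?_⟩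
    exact (hasDerivAt_space (hasFDerivAt_kerInt hg.continuous i l _)).congr_deriv (by ring)
  | traceL i l m h =>
    refine ⟨_, Rep.traceL i l (m + 1) (by omega), fun g hg x t => ?_⟩
    exact (hasDerivAt_space (hasFDerivAt_traceL
      (hg.of_le (by exact_mod_cast Nat.succ_le_succ h)) i l _)).congr_deriv (by ring)
  | traceR i l m h =>
    refine ⟨_, Rep.traceR i l (m + 1) (by omega), fun g hg x t => ?_⟩
    exact (hasDerivAt_space (hasFDerivAt_traceR
      (hg.of_le (by exact_mod_cast Nat.succ_le_succ h)) i l _)).congr_deriv (by ring)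
  | add _ _ ihS ihT =>
    obtain ⟨S', hS', dS⟩ := ihS
    obtain ⟨T', hT', dT⟩ := ihT
    exact ⟨_, hS'.add hT', fun g hg x t => (dS g hg x t).add (dT g hg x t)⟩
  | smul c _ ih =>
    obtain ⟨T', hT', dT⟩ := ih
    exact ⟨_, hT'.smul c, fun g hg x t => (dT g hg x t).const_mul c⟩

/-- Zero drift makes -λ₁∂_ξ - λ₂∂_η act on the kernel as λ₁ν(∂_a + ∂_b) = -λ₁ν ∂_a∂_b. This is the
gain of two, and the source of the faster decay of time derivatives. -/
theorem Rep.time_deriv {μ ν : ℝ} {N M : ℕ} {T : (ℝ → ℝ) → ℝ → ℝ → ℝ} {lam₁ lam₂ : ℝ}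
    (hlam : lam₁ * ν = -(lam₂ * μ)) (hT : Rep μ ν N M T) :
    ∃ T', Rep μ ν (N + 2) (M + 1) T' ∧ ∀ g : ℝ → ℝ, ContDiff ℝ (M + 1 : ℕ) g → ∀ x t : ℝ,
      HasDerivAt (fun s => T g (x - lam₁ * s) (x - lam₂ * s))
        (T' g (x - lam₁ * t) (x - lam₂ * t)) t := by
  induction hT with
  | kerInt i l h =>
    refine ⟨_, ((Rep.kerInt (i + 1) (l + 1) (by omega)).smul (-(lam₁ * ν))).add
      (((Rep.traceL i l 0 (by omega)).smul lam₁).add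
        ((Rep.traceR i l 0 (by omega)).smul (-lam₂))),
      fun g hg x t => ?_⟩
    refine (hasDerivAt_time (hasFDerivAt_kerInt hg.continuous i l _)).congr_deriv ?_
    rw [kerInt_succ_succ hg.continuous]
    linear_combination
      (-ARZ.kerInt μ ν (i + 1) l g (x - lam₁ * t) (x - lam₂ * t)) * hlam
  | traceL i l m h =>
    refine ⟨_, ((Rep.traceL (i + 1) l m (by omega)).smul (lam₁ * μ - lam₂ * μ)).add
      ((Rep.traceL i l (m + 1) (by omega)).smul (-lam₁)), fun g hg x t => ?_⟩
    exact (hasDerivAt_time (hasFDerivAt_traceL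
      (hg.of_le (by exact_mod_cast Nat.succ_le_succ h)) i l _)).congr_deriv (by ring)
  | traceR i l m h =>
    refine ⟨_, ((Rep.traceR i (l + 1) m (by omega)).smul (lam₁ * ν - lam₂ * ν)).add
      ((Rep.traceR i l (m + 1) (by omega)).smul (-lam₂)), fun g hg x t => ?_⟩
    exact (hasDerivAt_time (hasFDerivAt_traceR
      (hg.of_le (by exact_mod_cast Nat.succ_le_succ h)) i l _)).congr_deriv (by ring)
  | add _ _ ihS ihT =>
    obtain ⟨S', hS', dS⟩ := ihS
    obtain ⟨T', hT', dT⟩ := ihT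
    exact ⟨_, hS'.add hT', fun g hg x t => (dS g hg x t).add (dT g hg x t)⟩
  | smul c _ ih =>
    obtain ⟨T', hT', dT⟩ := ih
    exact ⟨_, hT'.smul c, fun g hg x t => (dT g hg x t).const_mul c⟩

theorem Rep.contDiff {μ ν : ℝ} {N n : ℕ} {T : (ℝ → ℝ) → ℝ → ℝ → ℝ} (hT : Rep μ ν N 0 T)
    {g : ℝ → ℝ} (hg : ContDiff ℝ n g) : ContDiff ℝ n fun z : ℝ × ℝ => T g z.1 z.2 := by
  induction hT with
  | kerInt i l h => exact contDiff_kerInt hg i l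
  | traceL i l m h =>
    obtain rfl : m = 0 := by omega
    exact contDiff_traceL hg i l
  | traceR i l m h =>
    obtain rfl : m = 0 := by omega
    exact contDiff_traceR hg i l
  | add _ _ ihS ihT => exact ihS.add ihT
  | smul c _ ih => exact contDiff_const.mul ih

/-- Two operators are carried together because the solution depends linearly on two data, the
initial W and the initial V. -/
theorem Rep.iteratedDeriv_space {μ ν : ℝ} {N M : ℕ} {S T : (ℝ → ℝ) → ℝ → ℝ → ℝ} (lam₁ lam₂ : ℝ)
    (hS : Rep μ ν N M S) (hT : Rep μ ν N M T) (k : ℕ) :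
    ∃ S' T', Rep μ ν (N + k) (M + k) S' ∧ Rep μ ν (N + k) (M + k) T' ∧
      ∀ f g : ℝ → ℝ, ContDiff ℝ (M + k : ℕ) f → ContDiff ℝ (M + k : ℕ) g → ∀ x t : ℝ,
      iteratedDeriv k (fun y => S f (y - lam₁ * t) (y - lam₂ * t) +
          T g (y - lam₁ * t) (y - lam₂ * t)) x =
        S' f (x - lam₁ * t) (x - lam₂ * t) + T' g (x - lam₁ * t) (x - lam₂ * t) := by
  induction k with
  | zero => exact ⟨S, T, hS, hT, fun f g _ _ x t => by simp⟩
  | succ k ih =>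
    obtain ⟨S₁, T₁, hS₁, hT₁, d⟩ := ih
    obtain ⟨S₂, hS₂, dS⟩ := hS₁.space_deriv lam₁ lam₂
    obtain ⟨T₂, hT₂, dT⟩ := hT₁.space_deriv lam₁ lam₂
    refine ⟨S₂, T₂, hS₂, hT₂, fun f g hf hg x t => ?_⟩
    rw [iteratedDeriv_succ, funext fun y => d f g (hf.of_le (by exact_mod_cast Nat.le_succ _))
      (hg.of_le (by exact_mod_cast Nat.le_succ _)) y t]
    exact ((dS f hf x t).add (dT g hg x t)).deriv

theorem Rep.iteratedDerivWithin_time {μ ν : ℝ} {N M : ℕ} {S T : (ℝ → ℝ) → ℝ → ℝ → ℝ}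
    {lam₁ lam₂ : ℝ} (hlam : lam₁ * ν = -(lam₂ * μ)) (hS : Rep μ ν N M S) (hT : Rep μ ν N M T)
    (n : ℕ) :
    ∃ S' T', Rep μ ν (N + 2 * n) (M + n) S' ∧ Rep μ ν (N + 2 * n) (M + n) T' ∧
      ∀ f g : ℝ → ℝ, ContDiff ℝ (M + n : ℕ) f → ContDiff ℝ (M + n : ℕ) g → ∀ x t : ℝ, 0 ≤ t →
      iteratedDerivWithin n (fun s => S f (x - lam₁ * s) (x - lam₂ * s) +
          T g (x - lam₁ * s) (x - lam₂ * s)) (Ici 0) t =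
        S' f (x - lam₁ * t) (x - lam₂ * t) + T' g (x - lam₁ * t) (x - lam₂ * t) := by
  induction n with
  | zero => exact ⟨S, T, hS, hT, fun f g _ _ x t _ => by simp⟩
  | succ n ih =>
    obtain ⟨S₁, T₁, hS₁, hT₁, d⟩ := ih
    obtain ⟨S₂, hS₂, dS⟩ := hS₁.time_deriv hlam
    obtain ⟨T₂, hT₂, dT⟩ := hT₁.time_deriv hlam
    refine ⟨S₂, T₂, hS₂, hT₂, fun f g hf hg x t ht => ?_⟩
    have e : EqOn (iteratedDerivWithin n (fun s => S f (x - lam₁ * s) (x - lam₂ * s) +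
          T g (x - lam₁ * s) (x - lam₂ * s)) (Ici 0))
        (fun s => S₁ f (x - lam₁ * s) (x - lam₂ * s) + T₁ g (x - lam₁ * s) (x - lam₂ * s))
        (Ici 0) := fun s hs =>
      d f g (hf.of_le (by exact_mod_cast Nat.le_succ _))
        (hg.of_le (by exact_mod_cast Nat.le_succ _)) x s hs
    rw [iteratedDerivWithin_succ, derivWithin_congr e (e ht)]
    exact ((dS f hf x t).add (dT g hg x t)).hasDerivWithinAt.derivWithin (uniqueDiffOn_Ici 0 t ht)

theorem Rep.partialTX_eq {μ ν : ℝ} {S T : (ℝ → ℝ) → ℝ → ℝ → ℝ}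
    {lam₁ lam₂ : ℝ} (hlam : lam₁ * ν = -(lam₂ * μ)) (hS : Rep μ ν 0 0 S) (hT : Rep μ ν 0 0 T)
    (n k : ℕ) :
    ∃ S' T', Rep μ ν (k + 2 * n) (k + n) S' ∧ Rep μ ν (k + 2 * n) (k + n) T' ∧
      ∀ f g : ℝ → ℝ, ContDiff ℝ (k + n : ℕ) f → ContDiff ℝ (k + n : ℕ) g →
      ∀ x t : ℝ, 0 ≤ t →
      partialTX n k (fun x t => S f (x - lam₁ * t) (x - lam₂ * t) +
          T g (x - lam₁ * t) (x - lam₂ * t)) x t =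
        S' f (x - lam₁ * t) (x - lam₂ * t) + T' g (x - lam₁ * t) (x - lam₂ * t) := by
  obtain ⟨S₁, T₁, hS₁, hT₁, d⟩ := hS.iteratedDeriv_space lam₁ lam₂ hT k
  rw [zero_add] at hS₁ hT₁ d
  obtain ⟨S₂, T₂, hS₂, hT₂, d'⟩ := hS₁.iteratedDerivWithin_time hlam hT₁ n
  refine ⟨S₂, T₂, hS₂, hT₂, fun f g hf hg x t ht => ?_⟩
  rw [partialTX, ← d' f g hf hg x t ht,
    funext fun s => d f g (hf.of_le (by exact_mod_cast Nat.le_add_right _ _))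
      (hg.of_le (by exact_mod_cast Nat.le_add_right _ _)) x s]

/-! ### Decay of the operators of the class -/

/-- The Gaussian rate `a_L`. -/
def gaussRate (μ ν lam₁ lam₂ : ℝ) : ℝ := (μ + ν) ^ 2 / (8 * (1 + (μ + ν) * (lam₁ - lam₂)))

/-- The exponential rate `b_L`. -/
def expRate (μ ν lam₁ lam₂ : ℝ) : ℝ := min μ ν * (lam₁ - lam₂) / 8

section

variable {μ ν lam₁ lam₂ : ℝ}

/-- For q between the characteristics, a + b lies between multiples of t, and zero drift turns a - b
into (μ+ν)(x-q). The lower bound on 1 + a + b gives the power of 1 + t, the upper bound gives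
`gaussRate`. -/
theorem abs_ker_cone_le (hμ : 0 < μ) (hν : 0 < ν) (hL : 0 < lam₁ - lam₂)
    (hlam : lam₁ * ν = -(lam₂ * μ)) (i l : ℕ) :
    ∃ C : ℝ, 0 < C ∧ ∀ x t q : ℝ, 0 ≤ t → q ∈ Icc (x - lam₁ * t) (x - lam₂ * t) →
      |ker i l (μ * (x - lam₂ * t - q)) (ν * (q - (x - lam₁ * t)))| ≤
        C / √(1 + t) ^ (i + l + 1) *
          Real.exp (-gaussRate μ ν lam₁ lam₂ * ((x - q) ^ 2 / (1 + t))) := by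
  obtain ⟨C, hC, hb⟩ := abs_ker_le i l
  set m := min 1 (min μ ν * (lam₁ - lam₂)) with hm
  have hmin : 0 < min μ ν := lt_min hμ hν
  have hm0 : 0 < m := lt_min one_pos (mul_pos hmin hL)
  refine ⟨C / √m ^ (i + l + 1), by positivity, fun x t q ht hq => ?_⟩
  have hs : 0 ≤ x - lam₂ * t - q := by linarith [hq.2]
  have hr : 0 ≤ q - (x - lam₁ * t) := by linarith [hq.1]
  have hsum : (x - lam₂ * t - q) + (q - (x - lam₁ * t)) = (lam₁ - lam₂) * t := by ring
  generalize hs' : x - lam₂ * t - q = s at *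
  generalize hr' : q - (x - lam₁ * t) = r at *
  have hdiff : μ * s - ν * r = (μ + ν) * (x - q) := by
    rw [← hs', ← hr']
    linear_combination (-t) * hlam
  have hlow : m * (1 + t) ≤ 1 + μ * s + ν * r := by
    have h1 : min μ ν * s ≤ μ * s := mul_le_mul_of_nonneg_right (min_le_left _ _) hs
    have h2 : min μ ν * r ≤ ν * r := mul_le_mul_of_nonneg_right (min_le_right _ _) hr
    have h3 : m * t ≤ min μ ν * (lam₁ - lam₂) * t :=
      mul_le_mul_of_nonneg_right (min_le_right _ _) ht
    have h4 : m ≤ 1 := min_le_left _ _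
    have h5 : min μ ν * s + min μ ν * r = min μ ν * (lam₁ - lam₂) * t := by
      rw [← mul_add, hsum]; ring
    linarith
  have hup : 1 + μ * s + ν * r ≤ (1 + (μ + ν) * (lam₁ - lam₂)) * (1 + t) := by
    have h1 : 0 ≤ (μ + ν) * (lam₁ - lam₂) := by positivity
    have h2 : (μ + ν) * (lam₁ - lam₂) * t = (μ + ν) * (s + r) := by rw [hsum]; ring
    nlinarith [mul_nonneg hμ.le hr, mul_nonneg hν.le hs]
  have hS0 : 0 < 1 + μ * s + ν * r := by positivity
  refine (hb _ _ (by positivity) (by positivity)).trans ?_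
  rw [hdiff]
  have e1 : C / √m ^ (i + l + 1) / √(1 + t) ^ (i + l + 1) = C / √(m * (1 + t)) ^ (i + l + 1) := by
    rw [Real.sqrt_mul hm0.le, mul_pow, div_div]
  rw [e1]
  have e2 : -(((μ + ν) * (x - q)) ^ 2 / (8 * (1 + μ * s + ν * r))) ≤
      -gaussRate μ ν lam₁ lam₂ * ((x - q) ^ 2 / (1 + t)) := by
    rw [neg_mul, neg_le_neg_iff, gaussRate, div_mul_div_comm, mul_pow]
    refine div_le_div_of_nonneg_left (by positivity) (by positivity) ?_
    linarith
  have e3 : 0 < m * (1 + t) := by positivity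
  gcongr

theorem exp_neg_sq_div_le {a : ℝ} (ha : 0 ≤ a) :
    Real.exp (-(a ^ 2 / (8 * (1 + a)))) ≤ Real.exp 1 * Real.exp (-(a / 8)) := by
  rw [← Real.exp_add]
  gcongr
  have : a / 8 - 1 ≤ a ^ 2 / (8 * (1 + a)) := by
    rw [le_div_iff₀ (by positivity)]
    nlinarith
  linarith

/-- On a characteristic one argument vanishes, so (a-b)²/(1+a+b) grows linearly and the Gaussian is
an exponential. -/
theorem abs_ker_trace_le (i l : ℕ) : ∃ C : ℝ, 0 < C ∧ ∀ a : ℝ, 0 ≤ a →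
    |ker i l a 0| ≤ C * Real.exp (-(a / 8)) ∧ |ker i l 0 a| ≤ C * Real.exp (-(a / 8)) := by
  obtain ⟨C, hC, hb⟩ := abs_ker_le i l
  refine ⟨C * Real.exp 1, by positivity, fun a ha => ?_⟩
  have h1 : C / √(1 + a) ^ (i + l + 1) ≤ C :=
    div_le_self hC.le (one_le_pow₀ (Real.one_le_sqrt.2 (by linarith)))
  have h2 := exp_neg_sq_div_le ha
  have h3 : C / √(1 + a) ^ (i + l + 1) * Real.exp (-(a ^ 2 / (8 * (1 + a)))) ≤
      C * Real.exp 1 * Real.exp (-(a / 8)) := by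
    rw [mul_assoc]
    gcongr
  constructor
  · simpa using (hb a 0 ha le_rfl).trans (by simpa using h3)
  · simpa using (hb 0 a le_rfl ha).trans (by simpa using h3)

/-- The Gaussian average of `|g|`. -/
def gaussInt (aL lam₁ lam₂ : ℝ) (g : ℝ → ℝ) (x t : ℝ) : ℝ :=
  ∫ q in (x - lam₁ * t)..(x - lam₂ * t), Real.exp (-aL * ((x - q) ^ 2 / (1 + t))) * |g q|

/-- The sum of the absolute values of the derivatives of `g` of order at most `M` at the feet of the
two characteristics. -/
def traceSum (M : ℕ) (g : ℝ → ℝ) (ξ η : ℝ) : ℝ :=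
  ∑ m ∈ Finset.range (M + 1), (|iteratedDeriv m g ξ| + |iteratedDeriv m g η|)

theorem gaussInt_nonneg (hL : 0 < lam₁ - lam₂) (aL : ℝ) (g : ℝ → ℝ) (x : ℝ) {t : ℝ}
    (ht : 0 ≤ t) : 0 ≤ gaussInt aL lam₁ lam₂ g x t := by
  refine intervalIntegral.integral_nonneg ?_ fun q _ => by positivity
  nlinarith [mul_nonneg hL.le ht]

theorem traceSum_nonneg (M : ℕ) (g : ℝ → ℝ) (ξ η : ℝ) : 0 ≤ traceSum M g ξ η :=
  Finset.sum_nonneg fun _ _ => by positivity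

theorem Rep.abs_le (hμ : 0 < μ) (hν : 0 < ν) (hL : 0 < lam₁ - lam₂)
    (hlam : lam₁ * ν = -(lam₂ * μ)) {N M : ℕ} {T : (ℝ → ℝ) → ℝ → ℝ → ℝ}
    (hT : Rep μ ν N M T) :
    ∃ C : ℝ, 0 < C ∧ ∀ g : ℝ → ℝ, Continuous g → ∀ x t : ℝ, 0 ≤ t →
      |T g (x - lam₁ * t) (x - lam₂ * t)| ≤
        C / √(1 + t) ^ (N + 1) * gaussInt (gaussRate μ ν lam₁ lam₂) lam₁ lam₂ g x t +
        C * Real.exp (-expRate μ ν lam₁ lam₂ * t) *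
          traceSum M g (x - lam₁ * t) (x - lam₂ * t) := by
  -- Common to both traces: κ is μ on the first characteristic and ν on the second, d the kernel
  -- value and s the derivative of the data.
  have trace : ∀ (C κ d t s : ℝ) (m : ℕ) (g : ℝ → ℝ) (ξ η : ℝ), 0 < C → min μ ν ≤ κ → 0 ≤ t →
      m ≤ M → |d| ≤ C * Real.exp (-(κ * ((lam₁ - lam₂) * t) / 8)) →
      |s| ≤ |iteratedDeriv m g ξ| + |iteratedDeriv m g η| →
      |d * s| ≤ C * Real.exp (-expRate μ ν lam₁ lam₂ * t) * traceSum M g ξ η := by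
    intro C κ d t s m g ξ η hC hκ ht hm hd hs
    rw [abs_mul]
    have h1 : |d| ≤ C * Real.exp (-expRate μ ν lam₁ lam₂ * t) := by
      refine hd.trans ?_
      gcongr
      have := mul_le_mul_of_nonneg_right hκ (mul_nonneg hL.le ht)
      rw [expRate]
      linarith
    have h2 : |s| ≤ traceSum M g ξ η := hs.trans
      (Finset.single_le_sum (f := fun m => |iteratedDeriv m g ξ| + |iteratedDeriv m g η|)
        (fun _ _ => by positivity) (Finset.mem_range.2 (by omega)))
    exact mul_le_mul h1 h2 (abs_nonneg _) (by positivity)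
  induction hT with
  | kerInt i l h =>
    obtain ⟨C, hC, hb⟩ := abs_ker_cone_le hμ hν hL hlam i l
    refine ⟨C, hC, fun g hg x t ht => ?_⟩
    have h0 : 0 ≤ C * Real.exp (-expRate μ ν lam₁ lam₂ * t) *
        traceSum M g (x - lam₁ * t) (x - lam₂ * t) :=
      mul_nonneg (by positivity) (traceSum_nonneg _ _ _ _)
    refine le_add_of_le_of_nonneg ?_ h0
    have hle : x - lam₁ * t ≤ x - lam₂ * t := by nlinarith [mul_nonneg hL.le ht]
    rw [ARZ.kerInt, gaussInt, ← intervalIntegral.integral_const_mul, ← Real.norm_eq_abs]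
    refine intervalIntegral.norm_integral_le_of_norm_le hle ?_ ?_
    · refine Eventually.of_forall fun q hq => ?_
      rw [Real.norm_eq_abs, abs_mul, ← mul_assoc]
      refine mul_le_mul_of_nonneg_right ((hb x t q ht ⟨hq.1.le, hq.2⟩).trans ?_) (abs_nonneg _)
      gcongr
      · exact Real.one_le_sqrt.2 (by linarith)
    · exact Continuous.intervalIntegrable (by fun_prop) _ _
  | traceL i l m h =>
    obtain ⟨C, hC, hb⟩ := abs_ker_trace_le i l
    refine ⟨C, hC, fun g hg x t ht => ?_⟩
    refine le_add_of_nonneg_of_le (mul_nonneg (by positivity) (gaussInt_nonneg hL _ _ _ ht)) ?_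
    have e : x - lam₂ * t - (x - lam₁ * t) = (lam₁ - lam₂) * t := by ring
    rw [ARZ.traceL, e]
    exact trace C μ _ t _ m g _ _ hC (min_le_left _ _) ht h (hb _ (by positivity)).1
      (le_add_of_nonneg_right (abs_nonneg _))
  | traceR i l m h =>
    obtain ⟨C, hC, hb⟩ := abs_ker_trace_le i l
    refine ⟨C, hC, fun g hg x t ht => ?_⟩
    refine le_add_of_nonneg_of_le (mul_nonneg (by positivity) (gaussInt_nonneg hL _ _ _ ht)) ?_
    have e : x - lam₂ * t - (x - lam₁ * t) = (lam₁ - lam₂) * t := by ring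
    rw [ARZ.traceR, e]
    exact trace C ν _ t _ m g _ _ hC (min_le_right _ _) ht h (hb _ (by positivity)).2
      (le_add_of_nonneg_left (abs_nonneg _))
  | add _ _ ihS ihT =>
    obtain ⟨C, hC, hb⟩ := ihS
    obtain ⟨D, hD, hb'⟩ := ihT
    refine ⟨C + D, by positivity, fun g hg x t ht => (abs_add_le _ _).trans ?_⟩
    refine (add_le_add (hb g hg x t ht) (hb' g hg x t ht)).trans_eq ?_
    ring
  | smul c _ ih =>
    obtain ⟨C, hC, hb⟩ := ih
    -- The 1 keeps the constant positive when c = 0.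
    refine ⟨(|c| + 1) * C, by positivity, fun g hg x t ht => ?_⟩
    have h1 := gaussInt_nonneg hL (gaussRate μ ν lam₁ lam₂) g x ht
    have h2 := traceSum_nonneg M g (x - lam₁ * t) (x - lam₂ * t)
    rw [abs_mul]
    refine (mul_le_mul (by linarith : |c| ≤ |c| + 1) (hb g hg x t ht) (abs_nonneg _)
      (by positivity)).trans_eq ?_
    ring

end

/-! ### Uniqueness -/

/-- Both one-variable partials are values of the same derivative within the half-plane, so the chain
rule along a characteristic holds up to t = 0. -/
theorem IsCk.hasDerivWithinAt_line {f : ℝ → ℝ → ℝ} (hf : IsCk 1 f) (x c : ℝ) {t : ℝ}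
    (ht : 0 ≤ t) :
    HasDerivWithinAt (fun s => f (x + c * s) s)
      (partialTX 1 0 f (x + c * t) t + c * partialTX 0 1 f (x + c * t) t) (Ici 0) t := by
  have hd : DifferentiableWithinAt ℝ (fun z : ℝ × ℝ => f z.1 z.2) (univ ×ˢ Ici 0) (x + c * t, t) :=
    hf.differentiableOn (by simp) _ ⟨mem_univ _, ht⟩
  set L := fderivWithin ℝ (fun z : ℝ × ℝ => f z.1 z.2) (univ ×ˢ Ici 0) (x + c * t, t)
  have hL : HasFDerivWithinAt (fun z : ℝ × ℝ => f z.1 z.2) L (univ ×ˢ Ici 0) (x + c * t, t) :=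
    hd.hasFDerivWithinAt
  have h1 : partialTX 1 0 f (x + c * t) t = L (0, 1) := by
    have := HasFDerivWithinAt.comp_hasDerivWithinAt (s := Ici 0) (f := fun s : ℝ => (x + c * t, s))
      (l := fun z : ℝ × ℝ => f z.1 z.2) t hL
      ((hasDerivWithinAt_const _ _ _).prodMk (hasDerivWithinAt_id _ _))
      (fun s hs => ⟨mem_univ _, hs⟩)
    rw [partialTX, iteratedDerivWithin_one]
    simpa [Function.comp_def] using this.derivWithin (uniqueDiffOn_Ici 0 t ht)
  have h2 : partialTX 0 1 f (x + c * t) t = L (1, 0) := by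
    have := HasFDerivWithinAt.comp_hasDerivWithinAt (s := univ) (f := fun y : ℝ => (y, t))
      (l := fun z : ℝ × ℝ => f z.1 z.2) (x + c * t) hL
      ((hasDerivWithinAt_id _ _).prodMk (hasDerivWithinAt_const _ _ _))
      (fun s _ => ⟨mem_univ _, ht⟩)
    rw [partialTX, iteratedDerivWithin_zero, iteratedDeriv_one]
    simpa [Function.comp_def] using (hasDerivWithinAt_univ.1 this).deriv
  have h3 : HasDerivWithinAt (fun s : ℝ => (x + c * s, s)) (c, (1 : ℝ)) (Ici 0) t := by
    refine HasDerivWithinAt.prodMk ?_ (hasDerivWithinAt_id _ _)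
    simpa using ((hasDerivWithinAt_id t (Ici 0)).const_mul c).const_add x
  have h4 := HasFDerivWithinAt.comp_hasDerivWithinAt (s := Ici 0) (f := fun s : ℝ => (x + c * s, s))
      (l := fun z : ℝ × ℝ => f z.1 z.2) t hL h3 (fun s hs => ⟨mem_univ _, hs⟩)
  refine h4.congr_deriv ?_
  rw [h1, h2, add_comm, ← smul_eq_mul, ← map_smul, ← map_add]
  simp

/-- A linear system in diagonal form with zero initial data has only the zero solution; no growth
condition is needed, the propagation speeds being finite. -/
theorem diagonal_system_eq_zero {W V : ℝ → ℝ → ℝ} {c₁ c₂ a b a' b' : ℝ}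
    (hW : ContinuousOn (fun z : ℝ × ℝ => W z.1 z.2) (univ ×ˢ Ici 0))
    (hV : ContinuousOn (fun z : ℝ × ℝ => V z.1 z.2) (univ ×ˢ Ici 0))
    (dW : ∀ x t, 0 ≤ t → HasDerivWithinAt (fun s => W (x + c₁ * s) s)
      (a * W (x + c₁ * t) t + b * V (x + c₁ * t) t) (Ici 0) t)
    (dV : ∀ x t, 0 ≤ t → HasDerivWithinAt (fun s => V (x + c₂ * s) s)
      (a' * W (x + c₂ * t) t + b' * V (x + c₂ * t) t) (Ici 0) t)
    (iW : ∀ x, W x 0 = 0) (iV : ∀ x, V x 0 = 0) (x₀ T : ℝ) (hT : 0 ≤ T) :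
    W x₀ T = 0 ∧ V x₀ T = 0 := by
  set C := |c₁| + |c₂|
  set L := |a| + |b| + |a'| + |b'|
  have hC : 0 ≤ C := by positivity
  have hL : 0 ≤ L := by positivity
  have hK : IsCompact (Icc (x₀ - C * T) (x₀ + C * T) ×ˢ Icc 0 T) := isCompact_Icc.prod isCompact_Icc
  have hsub : Icc (x₀ - C * T) (x₀ + C * T) ×ˢ Icc 0 T ⊆ univ ×ˢ Ici (0 : ℝ) :=
    prod_mono (subset_univ _) Icc_subset_Ici_self
  obtain ⟨M₁, hM₁⟩ := hK.exists_bound_of_continuousOn (hW.mono hsub)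
  obtain ⟨M₂, hM₂⟩ := hK.exists_bound_of_continuousOn (hV.mono hsub)
  set M := max M₁ M₂
  -- One Picard step for either unknown: integrating the n-th bound along a characteristic gives the
  -- next term M(Lt)^(n+1)/(n+1)!.
  have line : ∀ (f : ℝ → ℝ → ℝ) (c p q : ℝ), |c| ≤ C → |p| + |q| ≤ L → (∀ x, f x 0 = 0) →
      (∀ x t, 0 ≤ t → HasDerivWithinAt (fun s => f (x + c * s) s)
        (p * W (x + c * t) t + q * V (x + c * t) t) (Ici 0) t) → ∀ n : ℕ,
      (∀ x t, 0 ≤ t → t ≤ T → |x - x₀| ≤ C * (T - t) →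
        |W x t| ≤ M * ((L * t) ^ n / n.factorial) ∧ |V x t| ≤ M * ((L * t) ^ n / n.factorial)) →
      ∀ x t, 0 ≤ t → t ≤ T → |x - x₀| ≤ C * (T - t) →
        |f x t| ≤ M * ((L * t) ^ (n + 1) / (n + 1).factorial) := by
    intro f c p q hc hpq hi hd n ih x t ht htT hx
    have key := image_norm_le_of_norm_deriv_right_le_deriv_boundary (a := 0) (b := t)
      (f := fun s => f (x - c * t + c * s) s)
      (f' := fun s => p * W (x - c * t + c * s) s + q * V (x - c * t + c * s) s)
      (B := fun s => M * ((L * s) ^ (n + 1) / (n + 1).factorial))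
      (B' := fun s => L * (M * ((L * s) ^ n / n.factorial))) ?_ ?_ ?_ ?_ ?_ (right_mem_Icc.2 ht)
    · simpa using key
    · exact fun s hs => ((hd _ s hs.1).continuousWithinAt).mono Icc_subset_Ici_self
    · exact fun s hs => (hd _ s hs.1).mono (Ici_subset_Ici.2 hs.1)
    · simp [hi]
    · intro s
      have h1 : HasDerivAt (fun s => L * s) L s := by
        simpa using (hasDerivAt_id s).const_mul L
      refine (((h1.pow (n + 1)).div_const _).const_mul M).congr_deriv ?_
      rw [Nat.factorial_succ]
      have : (n.factorial : ℝ) ≠ 0 := by positivity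
      push_cast
      field_simp
    · intro s hs
      -- A characteristic followed backwards stays in the cone, since its speed is at most C.
      have hxs : |x - c * t + c * s - x₀| ≤ C * (T - s) := by
        have e : x - c * t + c * s - x₀ = (x - x₀) + (-(c * (t - s))) := by ring
        rw [e]
        refine (abs_add_le _ _).trans ?_
        rw [abs_neg, abs_mul, abs_of_nonneg (by linarith [hs.2] : 0 ≤ t - s)]
        have := mul_le_mul_of_nonneg_right hc (by linarith [hs.2] : 0 ≤ t - s)
        linarith
      obtain ⟨h1, h2⟩ := ih _ s hs.1 (hs.2.le.trans htT) hxs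
      rw [Real.norm_eq_abs]
      refine (abs_add_le _ _).trans ?_
      rw [abs_mul, abs_mul]
      have h3 := mul_le_mul_of_nonneg_left h1 (abs_nonneg p)
      have h4 := mul_le_mul_of_nonneg_left h2 (abs_nonneg q)
      have h5 := mul_le_mul_of_nonneg_right hpq ((abs_nonneg _).trans h1)
      linarith
  have main : ∀ n : ℕ, ∀ x t, 0 ≤ t → t ≤ T → |x - x₀| ≤ C * (T - t) →
      |W x t| ≤ M * ((L * t) ^ n / n.factorial) ∧ |V x t| ≤ M * ((L * t) ^ n / n.factorial) := by
    intro n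
    induction n with
    | zero =>
      intro x t ht htT hx
      have hx' := hx.trans (mul_le_mul_of_nonneg_left (by linarith : T - t ≤ T) hC)
      have hmem : (x, t) ∈ Icc (x₀ - C * T) (x₀ + C * T) ×ˢ Icc 0 T := by
        have := abs_le.1 hx'
        exact ⟨⟨by linarith, by linarith⟩, ht, htT⟩
      have h1 := hM₁ _ hmem
      have h2 := hM₂ _ hmem
      simp only [Real.norm_eq_abs] at h1 h2
      simpa using ⟨h1.trans (le_max_left M₁ M₂), h2.trans (le_max_right M₁ M₂)⟩
    | succ n ih =>
      intro x t ht htT hx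
      exact ⟨line W c₁ a b (le_add_of_nonneg_right (abs_nonneg _))
          (by simp only [L]; linarith [abs_nonneg a', abs_nonneg b']) iW dW n ih x t ht htT hx,
        line V c₂ a' b' (le_add_of_nonneg_left (abs_nonneg _))
          (by simp only [L]; linarith [abs_nonneg a, abs_nonneg b]) iV dV n ih x t ht htT hx⟩
  have lim : Tendsto (fun n : ℕ => M * ((L * T) ^ n / n.factorial)) atTop (𝓝 0) := by
    simpa using (FloorSemiring.tendsto_pow_div_factorial_atTop (L * T)).const_mul M
  have hmain := fun n => main n x₀ T hT le_rfl (by simp)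
  exact ⟨abs_nonpos_iff.1 (ge_of_tendsto' lim fun n => (hmain n).1),
    abs_nonpos_iff.1 (ge_of_tendsto' lim fun n => (hmain n).2)⟩

theorem IsSolution.hasDerivWithinAt_riemann {τ Uf ρ₀ : ℝ} {h ρᵢ uᵢ : ℝ → ℝ} {ρ u : ℝ → ℝ → ℝ}
    (H : IsSolution τ Uf h ρ₀ ρᵢ uᵢ ρ u) (x : ℝ) {t : ℝ} (ht : 0 ≤ t) :
    HasDerivWithinAt
      (fun s => deriv h ρ₀ * ρ (x + U Uf ρ₀ * s) s + u (x + U Uf ρ₀ * s) s)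
      (-(1 / τ * (Uf * ρ (x + U Uf ρ₀ * t) t + u (x + U Uf ρ₀ * t) t))) (Ici 0) t := by
  refine (((H.regular_rho.hasDerivWithinAt_line x (U Uf ρ₀) ht).const_mul (deriv h ρ₀)).add
    (H.regular_u.hasDerivWithinAt_line x (U Uf ρ₀) ht)).congr_deriv ?_
  linear_combination deriv h ρ₀ * H.eq_rho (x + U Uf ρ₀ * t) t ht + H.eq_u (x + U Uf ρ₀ * t) t ht

theorem IsSolution.hasDerivWithinAt_velocity {τ Uf ρ₀ : ℝ} {h ρᵢ uᵢ : ℝ → ℝ} {ρ u : ℝ → ℝ → ℝ}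
    (H : IsSolution τ Uf h ρ₀ ρᵢ uᵢ ρ u) (x : ℝ) {t : ℝ} (ht : 0 ≤ t) :
    HasDerivWithinAt (fun s => u (x + (U Uf ρ₀ - ρ₀ * deriv h ρ₀) * s) s)
      (-(1 / τ * (Uf * ρ (x + (U Uf ρ₀ - ρ₀ * deriv h ρ₀) * t) t
        + u (x + (U Uf ρ₀ - ρ₀ * deriv h ρ₀) * t) t))) (Ici 0) t := by
  refine (H.regular_u.hasDerivWithinAt_line x (U Uf ρ₀ - ρ₀ * deriv h ρ₀) ht).congr_deriv ?_
  linear_combination H.eq_u (x + (U Uf ρ₀ - ρ₀ * deriv h ρ₀) * t) t ht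

theorem IsSolution.unique {τ Uf ρ₀ : ℝ} {h ρᵢ uᵢ : ℝ → ℝ} {ρ u ρ' u' : ℝ → ℝ → ℝ}
    (hp : deriv h ρ₀ ≠ 0) (H : IsSolution τ Uf h ρ₀ ρᵢ uᵢ ρ u)
    (H' : IsSolution τ Uf h ρ₀ ρᵢ uᵢ ρ' u') (x t : ℝ) (ht : 0 ≤ t) :
    ρ' x t = ρ x t ∧ u' x t = u x t := by
  have cρ := H'.regular_rho.continuousOn.sub H.regular_rho.continuousOn
  have cu := H'.regular_u.continuousOn.sub H.regular_u.continuousOn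
  have key := diagonal_system_eq_zero
    (W := fun x t => deriv h ρ₀ * (ρ' x t - ρ x t) + (u' x t - u x t))
    (V := fun x t => u' x t - u x t) (c₁ := U Uf ρ₀) (c₂ := U Uf ρ₀ - ρ₀ * deriv h ρ₀)
    (a := -(1 / τ * (Uf / deriv h ρ₀))) (b := -(1 / τ * (1 - Uf / deriv h ρ₀)))
    (a' := -(1 / τ * (Uf / deriv h ρ₀))) (b' := -(1 / τ * (1 - Uf / deriv h ρ₀)))
    ((continuousOn_const.mul cρ).add cu) cu ?_ ?_ ?_ ?_ x t ht
  · obtain ⟨h1, h2⟩ := key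
    rw [h2, add_zero] at h1
    exact ⟨sub_eq_zero.1 ((mul_eq_zero.1 h1).resolve_left hp), sub_eq_zero.1 h2⟩
  · intro x t ht
    have := (H'.hasDerivWithinAt_riemann x ht).sub (H.hasDerivWithinAt_riemann x ht)
    refine (this.congr_deriv ?_).congr_of_eventuallyEq ?_ ?_
    · field_simp
      ring
    · exact Eventually.of_forall fun s => by simp; ring
    · simp; ring
  · intro x t ht
    have := (H'.hasDerivWithinAt_velocity x ht).sub (H.hasDerivWithinAt_velocity x ht)
    refine this.congr_deriv ?_
    field_simp
    ring
  · intro x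
    simp [H.init_rho, H'.init_rho, H.init_u, H'.init_u]
  · intro x
    simp [H.init_u, H'.init_u]

/-! ### The solution -/

/-- The contribution of its own data to the wave travelling along the first characteristic. -/
def selfR (μ ν : ℝ) (g : ℝ → ℝ) (ξ η : ℝ) : ℝ :=
  ν * kerInt μ ν 0 1 g ξ η + ν * kerInt μ ν 0 0 g ξ η + traceL μ 0 0 0 g ξ η

/-- The contribution of its own data to the wave travelling along the second characteristic. -/
def selfL (μ ν : ℝ) (g : ℝ → ℝ) (ξ η : ℝ) : ℝ :=
  μ * kerInt μ ν 1 0 g ξ η + μ * kerInt μ ν 0 0 g ξ η + traceR ν 0 0 0 g ξ η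

/-- The wave travelling along the first characteristic. -/
def waveR (μ ν : ℝ) (w v : ℝ → ℝ) (ξ η : ℝ) : ℝ :=
  selfR μ ν w ξ η + ν * kerInt μ ν 0 0 v ξ η

/-- The wave travelling along the second characteristic. -/
def waveL (μ ν : ℝ) (w v : ℝ → ℝ) (ξ η : ℝ) : ℝ :=
  μ * kerInt μ ν 0 0 w ξ η + selfL μ ν v ξ η

section

variable {μ ν : ℝ}

theorem rep_kerInt_zero : Rep μ ν 0 0 (kerInt μ ν 0 0) := Rep.kerInt 0 0 le_rfl

theorem rep_selfR : Rep μ ν 0 0 (selfR μ ν) :=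
  (((Rep.kerInt 0 1 (by omega)).smul ν).add (rep_kerInt_zero.smul ν)).add
    (Rep.traceL 0 0 0 le_rfl)

theorem rep_selfL : Rep μ ν 0 0 (selfL μ ν) :=
  (((Rep.kerInt 1 0 (by omega)).smul μ).add (rep_kerInt_zero.smul μ)).add
    (Rep.traceR 0 0 0 le_rfl)

theorem contDiff_waveR {n : ℕ} {w v : ℝ → ℝ} (hw : ContDiff ℝ n w) (hv : ContDiff ℝ n v) :
    ContDiff ℝ n fun z : ℝ × ℝ => waveR μ ν w v z.1 z.2 :=
  (rep_selfR.contDiff hw).add (contDiff_const.mul (rep_kerInt_zero.contDiff hv))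

theorem contDiff_waveL {n : ℕ} {w v : ℝ → ℝ} (hw : ContDiff ℝ n w) (hv : ContDiff ℝ n v) :
    ContDiff ℝ n fun z : ℝ × ℝ => waveL μ ν w v z.1 z.2 :=
  (contDiff_const.mul (rep_kerInt_zero.contDiff hw)).add (rep_selfL.contDiff hv)

theorem lin2_add (a b a' b' : ℝ) : lin2 a b + lin2 a' b' = lin2 (a + a') (b + b') := by
  ext <;> simp

theorem lin2_smul (c a b : ℝ) : c • lin2 a b = lin2 (c * a) (c * b) := by
  ext <;> simp

/-- Only the η-derivative is prescribed by the exchange system; the ξ-derivative stays anonymous and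
cancels in the equations. The telegraph identity handles the integrals, and the characteristic
values of the kernel handle the traces. -/
theorem exists_hasFDerivAt_waveR {w v : ℝ → ℝ} (hw : ContDiff ℝ 1 w) (hv : ContDiff ℝ 1 v)
    (z : ℝ × ℝ) : ∃ p, HasFDerivAt (fun z : ℝ × ℝ => waveR μ ν w v z.1 z.2)
      (lin2 p (-(μ * waveR μ ν w v z.1 z.2) + ν * waveL μ ν w v z.1 z.2)) z := by
  have hw0 := hw.continuous
  have h := ((((hasFDerivAt_kerInt (μ := μ) (ν := ν) hw0 0 1 z).const_mul ν).add
    ((hasFDerivAt_kerInt (μ := μ) (ν := ν) hw0 0 0 z).const_mul ν)).add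
    (hasFDerivAt_traceL (μ := μ) (m := 0) (by simpa using hw) 0 0 z)).add
    ((hasFDerivAt_kerInt (μ := μ) (ν := ν) hv.continuous 0 0 z).const_mul ν)
  simp only [lin2_smul, lin2_add] at h
  refine ⟨_, h.congr_fderiv (congrArg _ ?_)⟩
  have e1 := kerInt_succ_succ (μ := μ) (ν := ν) hw0 0 0 z.1 z.2
  have e2 : traceR ν 0 1 0 w z.1 z.2 = -traceR ν 0 0 0 w z.1 z.2 := by
    simp [traceR, ker_zero_one_left]
  have e3 : traceL μ 1 0 0 w z.1 z.2 = -traceL μ 0 0 0 w z.1 z.2 := by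
    simp [traceL, ker_one_zero_right]
  simp only [waveR, waveL, selfR, selfL, zero_add] at e1 ⊢
  linear_combination ν * μ * e1 + ν * e2 + μ * e3

theorem exists_hasFDerivAt_waveL {w v : ℝ → ℝ} (hw : ContDiff ℝ 1 w) (hv : ContDiff ℝ 1 v)
    (z : ℝ × ℝ) : ∃ q, HasFDerivAt (fun z : ℝ × ℝ => waveL μ ν w v z.1 z.2)
      (lin2 (-(μ * waveR μ ν w v z.1 z.2) + ν * waveL μ ν w v z.1 z.2) q) z := by
  have hv0 := hv.continuous
  have h := ((hasFDerivAt_kerInt (μ := μ) (ν := ν) hw.continuous 0 0 z).const_mul μ).add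
    ((((hasFDerivAt_kerInt (μ := μ) (ν := ν) hv0 1 0 z).const_mul μ).add
    ((hasFDerivAt_kerInt (μ := μ) (ν := ν) hv0 0 0 z).const_mul μ)).add
    (hasFDerivAt_traceR (ν := ν) (m := 0) (by simpa using hv) 0 0 z))
  simp only [lin2_smul, lin2_add] at h
  refine ⟨_, h.congr_fderiv (congrArg (fun a => lin2 a _) ?_)⟩
  have e1 := kerInt_succ_succ (μ := μ) (ν := ν) hv0 0 0 z.1 z.2
  have e2 : traceR ν 0 1 0 v z.1 z.2 = -traceR ν 0 0 0 v z.1 z.2 := by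
    simp [traceR, ker_zero_one_left]
  have e3 : traceL μ 1 0 0 v z.1 z.2 = -traceL μ 0 0 0 v z.1 z.2 := by
    simp [traceL, ker_one_zero_right]
  simp only [waveR, waveL, selfR, selfL, zero_add] at e1 ⊢
  linear_combination -(ν * μ * e1) - ν * e2 - μ * e3

theorem waveR_diag (w v : ℝ → ℝ) (x : ℝ) : waveR μ ν w v x x = w x := by
  simp [waveR, selfR, kerInt, traceL, ker_zero_zero]

theorem waveL_diag (w v : ℝ → ℝ) (x : ℝ) : waveL μ ν w v x x = v x := by
  simp [waveL, selfL, kerInt, traceR, ker_zero_zero]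

end

theorem partialTX_one_zero {f : ℝ → ℝ → ℝ} {x t d : ℝ} (ht : 0 ≤ t)
    (h : HasDerivAt (fun s => f x s) d t) : partialTX 1 0 f x t = d := by
  rw [partialTX, iteratedDerivWithin_one]
  simpa using h.hasDerivWithinAt.derivWithin (uniqueDiffOn_Ici 0 t ht)

theorem partialTX_zero_one {f : ℝ → ℝ → ℝ} {x t d : ℝ}
    (h : HasDerivAt (fun y => f y t) d x) : partialTX 0 1 f x t = d := by
  rw [partialTX, iteratedDerivWithin_zero, iteratedDeriv_one]
  exact h.deriv

/-- The density in characteristic coordinates. -/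
def densChar (μ ν p : ℝ) (w v : ℝ → ℝ) (ξ η : ℝ) : ℝ :=
  p⁻¹ * (waveR μ ν w v ξ η + waveL μ ν w v ξ η)

/-- The velocity in characteristic coordinates. -/
def velChar (μ ν : ℝ) (w v : ℝ → ℝ) (ξ η : ℝ) : ℝ := -waveL μ ν w v ξ η

theorem isCk_of_contDiff {f : ℝ → ℝ → ℝ} {n : ℕ} (c₁ c₂ : ℝ)
    (hf : ContDiff ℝ n fun z : ℝ × ℝ => f z.1 z.2) :
    IsCk n fun x t => f (x - c₁ * t) (x - c₂ * t) := by
  have e : ContDiff ℝ n fun z : ℝ × ℝ => (z.1 - c₁ * z.2, z.1 - c₂ * z.2) := by fun_prop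
  exact (ContDiff.comp (g := fun z : ℝ × ℝ => f z.1 z.2) hf e).contDiffOn

theorem isSolution_char {τ Uf ρ₀ μ ν : ℝ} {h ρᵢ uᵢ : ℝ → ℝ} (hp : deriv h ρ₀ ≠ 0)
    (hμ : ρ₀ * deriv h ρ₀ * μ = 1 / τ * (Uf / deriv h ρ₀))
    (hν : ρ₀ * deriv h ρ₀ * ν = 1 / τ * (1 - Uf / deriv h ρ₀))
    (hρ : ContDiff ℝ 1 ρᵢ) (hu : ContDiff ℝ 1 uᵢ) :
    IsSolution τ Uf h ρ₀ ρᵢ uᵢ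
      (fun x t => densChar μ ν (deriv h ρ₀) (fun y => deriv h ρ₀ * ρᵢ y + 1 * uᵢ y)
        (fun y => 0 * ρᵢ y + -1 * uᵢ y) (x - U Uf ρ₀ * t)
        (x - (U Uf ρ₀ - ρ₀ * deriv h ρ₀) * t))
      (fun x t => velChar μ ν (fun y => deriv h ρ₀ * ρᵢ y + 1 * uᵢ y)
        (fun y => 0 * ρᵢ y + -1 * uᵢ y) (x - U Uf ρ₀ * t)
        (x - (U Uf ρ₀ - ρ₀ * deriv h ρ₀) * t)) := by
  set p := deriv h ρ₀ with hpdef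
  have hw : ContDiff ℝ 1 fun y => p * ρᵢ y + 1 * uᵢ y := by fun_prop
  have hv : ContDiff ℝ 1 fun y => 0 * ρᵢ y + -1 * uᵢ y := by fun_prop
  generalize hw' : (fun y => p * ρᵢ y + 1 * uᵢ y) = w at *
  generalize hv' : (fun y => 0 * ρᵢ y + -1 * uᵢ y) = v at *
  have cR : ContDiff ℝ (1 : ℕ) fun z : ℝ × ℝ => waveR μ ν w v z.1 z.2 :=
    contDiff_waveR (by simpa using hw) (by simpa using hv)
  have cL : ContDiff ℝ (1 : ℕ) fun z : ℝ × ℝ => waveL μ ν w v z.1 z.2 :=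
    contDiff_waveL (by simpa using hw) (by simpa using hv)
  have key : ∀ x t : ℝ, ∃ a b : ℝ,
      HasFDerivAt (fun z : ℝ × ℝ => densChar μ ν p w v z.1 z.2)
        (lin2 (p⁻¹ * (a + (-(μ * waveR μ ν w v x t) + ν * waveL μ ν w v x t)))
          (p⁻¹ * ((-(μ * waveR μ ν w v x t) + ν * waveL μ ν w v x t) + b))) (x, t) ∧
      HasFDerivAt (fun z : ℝ × ℝ => velChar μ ν w v z.1 z.2)
        (lin2 (-(-(μ * waveR μ ν w v x t) + ν * waveL μ ν w v x t)) (-b)) (x, t) := by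
    intro x t
    obtain ⟨a, ha⟩ := exists_hasFDerivAt_waveR (μ := μ) (ν := ν) hw hv (x, t)
    obtain ⟨b, hb⟩ := exists_hasFDerivAt_waveL (μ := μ) (ν := ν) hw hv (x, t)
    refine ⟨a, b, ((ha.add hb).const_mul p⁻¹).congr_fderiv ?_, hb.neg.congr_fderiv ?_⟩
    · rw [lin2_add, lin2_smul]
    · ext <;> simp
  refine ⟨?_, ?_, ?_, ?_, ?_, ?_⟩
  · exact isCk_of_contDiff _ _ (contDiff_const.mul (cR.add cL))
  · exact isCk_of_contDiff _ _ cL.neg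
  · intro x t ht
    obtain ⟨a, b, h1, h2⟩ := key (x - U Uf ρ₀ * t) (x - (U Uf ρ₀ - ρ₀ * p) * t)
    rw [partialTX_one_zero ht (hasDerivAt_time h1), partialTX_zero_one (hasDerivAt_space h1),
      partialTX_zero_one (hasDerivAt_space h2)]
    -- The density equation is the conservation of W + V: the exchange terms cancel whatever μ and ν
    -- are. Their values matter only in the velocity equation.
    field_simp
    ring
  · intro x t ht
    obtain ⟨a, b, h1, h2⟩ := key (x - U Uf ρ₀ * t) (x - (U Uf ρ₀ - ρ₀ * p) * t)
    rw [partialTX_one_zero ht (hasDerivAt_time h2), partialTX_zero_one (hasDerivAt_space h2)]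
    simp only [densChar, velChar]
    generalize waveR μ ν w v (x - U Uf ρ₀ * t) (x - (U Uf ρ₀ - ρ₀ * p) * t) = W
    generalize waveL μ ν w v (x - U Uf ρ₀ * t) (x - (U Uf ρ₀ - ρ₀ * p) * t) = V
    linear_combination (-W) * hμ + V * hν
  · intro x
    simp only [mul_zero, sub_zero, densChar, waveR_diag, waveL_diag, ← hw', ← hv']
    field_simp
    ring
  · intro x
    simp only [mul_zero, sub_zero, velChar, waveL_diag, ← hv']
    ring

/-! ### The decay estimate -/

theorem gaussInt_combination_le {ρᵢ uᵢ : ℝ → ℝ} (hρ : Continuous ρᵢ) (hu : Continuous uᵢ)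
    {A B D : ℝ} (hA : |A| ≤ D) (hB : |B| ≤ D) {aL lam₁ lam₂ x t : ℝ} (hL : 0 < lam₁ - lam₂)
    (ht : 0 ≤ t) :
    gaussInt aL lam₁ lam₂ (fun y => A * ρᵢ y + B * uᵢ y) x t ≤
      D * ∫ y in (lam₂ * t)..(lam₁ * t),
        Real.exp (-aL * (y ^ 2 / (1 + t))) * (|uᵢ (x - y)| + |ρᵢ (x - y)|) := by
  have e := intervalIntegral.integral_comp_sub_left (a := lam₂ * t) (b := lam₁ * t)
    (fun q => Real.exp (-aL * ((x - q) ^ 2 / (1 + t))) * (|uᵢ q| + |ρᵢ q|)) x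
  simp only [sub_sub_cancel] at e
  rw [e, gaussInt, ← intervalIntegral.integral_const_mul]
  refine intervalIntegral.integral_mono_on (by nlinarith [mul_nonneg hL.le ht])
    (Continuous.intervalIntegrable (by fun_prop) _ _)
    (Continuous.intervalIntegrable (by fun_prop) _ _) fun q _ => ?_
  have h1 : |A * ρᵢ q + B * uᵢ q| ≤ D * (|uᵢ q| + |ρᵢ q|) := by
    refine (abs_add_le _ _).trans ?_
    rw [abs_mul, abs_mul]
    have := mul_le_mul_of_nonneg_right hA (abs_nonneg (ρᵢ q))
    have := mul_le_mul_of_nonneg_right hB (abs_nonneg (uᵢ q))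
    linarith
  refine (mul_le_mul_of_nonneg_left h1 (Real.exp_pos _).le).trans_eq ?_
  ring

theorem traceSum_combination_le {M : ℕ} {ρᵢ uᵢ : ℝ → ℝ} (hρ : ContDiff ℝ M ρᵢ)
    (hu : ContDiff ℝ M uᵢ) {A B D : ℝ} (hA : |A| ≤ D) (hB : |B| ≤ D) (ξ η : ℝ) :
    traceSum M (fun y => A * ρᵢ y + B * uᵢ y) ξ η ≤
      D * ∑ m ∈ Finset.range (M + 1), ((|iteratedDeriv m ρᵢ ξ| + |iteratedDeriv m uᵢ ξ|)
        + (|iteratedDeriv m ρᵢ η| + |iteratedDeriv m uᵢ η|)) := by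
  rw [traceSum, Finset.mul_sum]
  refine Finset.sum_le_sum fun m hm => ?_
  have hmM : (m : WithTop ℕ∞) ≤ (M : ℕ) := by
    exact_mod_cast Nat.lt_succ_iff.1 (Finset.mem_range.1 hm)
  have h1 : ∀ x, |iteratedDeriv m (fun y => A * ρᵢ y + B * uᵢ y) x| ≤
      D * (|iteratedDeriv m ρᵢ x| + |iteratedDeriv m uᵢ x|) := by
    intro x
    have cρ : ContDiffAt ℝ m ρᵢ x := (hρ.of_le hmM).contDiffAt
    have cu : ContDiffAt ℝ m uᵢ x := (hu.of_le hmM).contDiffAt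
    rw [iteratedDeriv_fun_add (contDiffAt_const.mul cρ) (contDiffAt_const.mul cu),
      iteratedDeriv_const_mul_field, iteratedDeriv_const_mul_field]
    refine (abs_add_le _ _).trans ?_
    rw [abs_mul, abs_mul]
    have := mul_le_mul_of_nonneg_right hA (abs_nonneg (iteratedDeriv m ρᵢ x))
    have := mul_le_mul_of_nonneg_right hB (abs_nonneg (iteratedDeriv m uᵢ x))
    linarith
  linarith [h1 ξ, h1 η]

theorem one_add_rpow_eq_sqrt_pow {t : ℝ} (ht : 0 ≤ t) (n k : ℕ) :
    (1 + t) ^ ((1 : ℝ) / 2 + (k : ℝ) / 2 + (n : ℝ)) = √(1 + t) ^ (k + 2 * n + 1) := by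
  rw [Real.sqrt_eq_rpow, ← Real.rpow_natCast, ← Real.rpow_mul (by positivity)]
  congr 1
  push_cast
  ring

theorem Rep.exists_partialTX_le {μ ν lam₁ lam₂ : ℝ} (hμ : 0 < μ) (hν : 0 < ν)
    (hL : 0 < lam₁ - lam₂) (hlam : lam₁ * ν = -(lam₂ * μ)) {S T : (ℝ → ℝ) → ℝ → ℝ → ℝ}
    (hS : Rep μ ν 0 0 S) (hT : Rep μ ν 0 0 T) {A B A' B' D : ℝ} (hA : |A| ≤ D) (hB : |B| ≤ D)
    (hA' : |A'| ≤ D) (hB' : |B'| ≤ D) (n k : ℕ) :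
    ∃ K : ℝ, 0 < K ∧ ∀ ρᵢ uᵢ : ℝ → ℝ, ContDiff ℝ (k + n : ℕ) ρᵢ → ContDiff ℝ (k + n : ℕ) uᵢ →
      ∀ x t : ℝ, 0 ≤ t →
      |partialTX n k (fun x t =>
          S (fun y => A * ρᵢ y + B * uᵢ y) (x - lam₁ * t) (x - lam₂ * t) +
          T (fun y => A' * ρᵢ y + B' * uᵢ y) (x - lam₁ * t) (x - lam₂ * t)) x t| ≤
        K / (1 + t) ^ ((1 : ℝ) / 2 + (k : ℝ) / 2 + (n : ℝ)) *
          (∫ y in (lam₂ * t)..(lam₁ * t),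
            Real.exp (-gaussRate μ ν lam₁ lam₂ * (y ^ 2 / (1 + t)))
              * (|uᵢ (x - y)| + |ρᵢ (x - y)|))
        + K * Real.exp (-expRate μ ν lam₁ lam₂ * t) *
          ∑ m ∈ Finset.range (n + k + 1),
            ((|iteratedDeriv m ρᵢ (x - lam₁ * t)| + |iteratedDeriv m uᵢ (x - lam₁ * t)|)
              + (|iteratedDeriv m ρᵢ (x - lam₂ * t)| + |iteratedDeriv m uᵢ (x - lam₂ * t)|)) := by
  obtain ⟨S', T', hS', hT', d⟩ := hS.partialTX_eq hlam hT n k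
  obtain ⟨C₁, hC₁, b₁⟩ := hS'.abs_le hμ hν hL hlam
  obtain ⟨C₂, hC₂, b₂⟩ := hT'.abs_le hμ hν hL hlam
  have hD : 0 ≤ D := (abs_nonneg A).trans hA
  -- D itself may be 0, hence D + 1.
  refine ⟨(C₁ + C₂) * (D + 1), by positivity, fun ρᵢ uᵢ hρ hu x t ht => ?_⟩
  have hD1 : D ≤ D + 1 := by linarith
  have c₁ : ContDiff ℝ (k + n : ℕ) fun y => A * ρᵢ y + B * uᵢ y := by fun_prop
  have c₂ : ContDiff ℝ (k + n : ℕ) fun y => A' * ρᵢ y + B' * uᵢ y := by fun_prop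
  rw [d _ _ c₁ c₂ x t ht, one_add_rpow_eq_sqrt_pow ht, add_comm n k]
  refine (abs_add_le _ _).trans ?_
  have p₁ := b₁ _ c₁.continuous x t ht
  have p₂ := b₂ _ c₂.continuous x t ht
  have g₁ := gaussInt_combination_le hρ.continuous hu.continuous (hA.trans hD1) (hB.trans hD1)
    (aL := gaussRate μ ν lam₁ lam₂) (x := x) hL ht
  have g₂ := gaussInt_combination_le hρ.continuous hu.continuous (hA'.trans hD1) (hB'.trans hD1)
    (aL := gaussRate μ ν lam₁ lam₂) (x := x) hL ht
  have s₁ := traceSum_combination_le hρ hu (hA.trans hD1) (hB.trans hD1) (x - lam₁ * t)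
    (x - lam₂ * t)
  have s₂ := traceSum_combination_le hρ hu (hA'.trans hD1) (hB'.trans hD1) (x - lam₁ * t)
    (x - lam₂ * t)
  have q₁ := mul_le_mul_of_nonneg_left g₁
    (by positivity : 0 ≤ C₁ / √(1 + t) ^ (k + 2 * n + 1))
  have q₂ := mul_le_mul_of_nonneg_left g₂
    (by positivity : 0 ≤ C₂ / √(1 + t) ^ (k + 2 * n + 1))
  have r₁ := mul_le_mul_of_nonneg_left s₁
    (by positivity : 0 ≤ C₁ * Real.exp (-expRate μ ν lam₁ lam₂ * t))
  have r₂ := mul_le_mul_of_nonneg_left s₂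
    (by positivity : 0 ≤ C₂ * Real.exp (-expRate μ ν lam₁ lam₂ * t))
  refine (add_le_add (p₁.trans (add_le_add q₁ r₁)) (p₂.trans (add_le_add q₂ r₂))).trans_eq ?_
  ring

end ARZ

end

/-! ### Choice of the constants and conclusion. -/

theorem mainTheorem2 (τ Uf ρ₀ p : ℝ) (hτ : 0 < τ) (hUf : 0 < Uf) (hρ₀ : ρ₀ ∈ Set.Ioo (0 : ℝ) 1) :
    -- the constants depend on the pressure law `h` only through `p = h'(ρ₀)`
    ∃ (aL bL : ℝ) (K : ℕ → ℕ → ℝ), 0 < aL ∧ 0 < bL ∧ (∀ n k, 0 < K n k) ∧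
      ∀ h : ℝ → ℝ, ARZ.IsPressure h → deriv h ρ₀ = p → 0 < ARZ.scc Uf h ρ₀ →
        0 < ARZ.lam1 Uf ρ₀ ∧ ARZ.lam2 Uf h ρ₀ < 0 ∧
        ∀ (j : ℕ), 2 ≤ j → ∀ ρᵢ uᵢ : ℝ → ℝ, ContDiff ℝ j ρᵢ → ContDiff ℝ j uᵢ →
          ∃ ρ u : ℝ → ℝ → ℝ,
            ARZ.IsSolution τ Uf h ρ₀ ρᵢ uᵢ ρ u ∧
            (∀ ρ' u' : ℝ → ℝ → ℝ, ARZ.IsSolution τ Uf h ρ₀ ρᵢ uᵢ ρ' u' →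
              ∀ x t, 0 ≤ t → ρ' x t = ρ x t ∧ u' x t = u x t) ∧
            ARZ.IsCk j ρ ∧ ARZ.IsCk j u ∧
            ∀ k n : ℕ, k + n ≤ j → ∀ x t : ℝ, 0 ≤ t →
              |ARZ.partialTX n k (ARZ.moving Uf ρ₀ u) x t|
                  + |ARZ.partialTX n k (ARZ.moving Uf ρ₀ ρ) x t| ≤
                K n k / (1 + t) ^ ((1 : ℝ) / 2 + (k : ℝ) / 2 + (n : ℝ)) *
                    (∫ y in (ARZ.lam2 Uf h ρ₀ * t)..(ARZ.lam1 Uf ρ₀ * t),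
                      Real.exp (-aL * (y ^ 2 / (1 + t))) * (|uᵢ (x - y)| + |ρᵢ (x - y)|))
                + K n k * Real.exp (-bL * t) *
                    ∑ m ∈ Finset.range (n + k + 1),
                      ((|iteratedDeriv m ρᵢ (x - ARZ.lam1 Uf ρ₀ * t)|
                          + |iteratedDeriv m uᵢ (x - ARZ.lam1 Uf ρ₀ * t)|)
                        + (|iteratedDeriv m ρᵢ (x - ARZ.lam2 Uf h ρ₀ * t)|
                          + |iteratedDeriv m uᵢ (x - ARZ.lam2 Uf h ρ₀ * t)|)) := by
  -- The constants are chosen before h. If p ≤ U_f no h meets the subcharacteristic condition, and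
  -- any positive values do.
  rcases le_or_gt p Uf with hpU | hpU
  · refine ⟨1, 1, fun _ _ => 1, one_pos, one_pos, fun _ _ => one_pos, fun h _ hh hs => ?_⟩
    rw [ARZ.scc, hh] at hs
    linarith
  have hr : 0 < ρ₀ := hρ₀.1
  have hp : 0 < p := hUf.trans hpU
  have hd : 0 < p - Uf := by linarith
  -- Exchange rates per unit time, divided by the relative speed ρ₀p = λ₁⁰ - λ₂⁰ to become rates per
  -- unit of characteristic coordinate.
  obtain ⟨μ, hμdef⟩ : ∃ μ, μ = Uf / (p * τ) / (ρ₀ * p) := ⟨_, rfl⟩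
  obtain ⟨ν, hνdef⟩ : ∃ ν, ν = (p - Uf) / (p * τ) / (ρ₀ * p) := ⟨_, rfl⟩
  have hμ : 0 < μ := by rw [hμdef]; positivity
  have hν : 0 < ν := by rw [hνdef]; positivity
  have hL : 0 < ρ₀ * Uf - ρ₀ * (Uf - p) := by
    have : ρ₀ * Uf - ρ₀ * (Uf - p) = ρ₀ * p := by ring
    rw [this]
    positivity
  have hlam : ρ₀ * Uf * ν = -(ρ₀ * (Uf - p) * μ) := by
    rw [hμdef, hνdef]
    field_simp
    ring
  -- The coefficients of the data w = pρᵢ + uᵢ and v = 0·ρᵢ - uᵢ have the common bound p + 1.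
  have b1 : |p| ≤ p + 1 := by rw [abs_of_pos hp]; linarith
  have b2 : |(1 : ℝ)| ≤ p + 1 := by rw [abs_one]; linarith
  have b3 : |(0 : ℝ)| ≤ p + 1 := by rw [abs_zero]; linarith
  have b4 : |(-1 : ℝ)| ≤ p + 1 := by rw [abs_neg, abs_one]; linarith
  choose Ku hKu bu using fun n k => ARZ.Rep.exists_partialTX_le hμ hν hL hlam
    (ARZ.rep_kerInt_zero.smul (-μ)) (ARZ.rep_selfL.smul (-1)) b1 b2 b3 b4 n k
  choose Kρ hKρ bρ using fun n k => ARZ.Rep.exists_partialTX_le hμ hν hL hlam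
    ((ARZ.rep_selfR.add (ARZ.rep_kerInt_zero.smul μ)).smul p⁻¹)
    (((ARZ.rep_kerInt_zero.smul ν).add ARZ.rep_selfL).smul p⁻¹) b1 b2 b3 b4 n k
  refine ⟨ARZ.gaussRate μ ν (ρ₀ * Uf) (ρ₀ * (Uf - p)),
    ARZ.expRate μ ν (ρ₀ * Uf) (ρ₀ * (Uf - p)), fun n k => Ku n k + Kρ n k, ?_, ?_,
    fun n k => add_pos (hKu n k) (hKρ n k), fun h _ hh _ => ⟨mul_pos hr hUf, ?_, ?_⟩⟩
  · exact div_pos (by positivity) (by positivity)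
  · exact div_pos (mul_pos (lt_min hμ hν) hL) (by norm_num)
  · rw [ARZ.lam2, hh]
    exact mul_neg_of_pos_of_neg hr (by linarith)
  intro j hj ρᵢ uᵢ hρ hu
  have h1j : ((1 : ℕ) : WithTop ℕ∞) ≤ (j : ℕ) := by exact_mod_cast (by omega : 1 ≤ j)
  have sol := ARZ.isSolution_char (τ := τ) (Uf := Uf) (ρ₀ := ρ₀) (μ := μ) (ν := ν) (h := h)
    (ρᵢ := ρᵢ) (uᵢ := uᵢ) (by rw [hh]; exact hp.ne')
    (by rw [hh, hμdef]; field_simp) (by rw [hh, hνdef]; field_simp)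
    (by simpa using hρ.of_le h1j) (by simpa using hu.of_le h1j)
  have cR : ContDiff ℝ j fun z : ℝ × ℝ => ARZ.waveR μ ν (fun y => deriv h ρ₀ * ρᵢ y + 1 * uᵢ y)
      (fun y => 0 * ρᵢ y + -1 * uᵢ y) z.1 z.2 :=
    ARZ.contDiff_waveR (by fun_prop) (by fun_prop)
  have cL : ContDiff ℝ j fun z : ℝ × ℝ => ARZ.waveL μ ν (fun y => deriv h ρ₀ * ρᵢ y + 1 * uᵢ y)
      (fun y => 0 * ρᵢ y + -1 * uᵢ y) z.1 z.2 :=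
    ARZ.contDiff_waveL (by fun_prop) (by fun_prop)
  refine ⟨_, _, sol, fun ρ' u' H x t ht => sol.unique (by rw [hh]; exact hp.ne') H x t ht,
    ARZ.isCk_of_contDiff _ _ (contDiff_const.mul (cR.add cL)),
    ARZ.isCk_of_contDiff _ _ cL.neg, ?_⟩
  intro k n hkn x t ht
  have hkn' : ((k + n : ℕ) : WithTop ℕ∞) ≤ (j : ℕ) := by exact_mod_cast hkn
  have Bu := bu n k ρᵢ uᵢ (hρ.of_le hkn') (hu.of_le hkn') x t ht
  have Bρ := bρ n k ρᵢ uᵢ (hρ.of_le hkn') (hu.of_le hkn') x t ht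
  have arg1 : ∀ x t : ℝ, x + ARZ.lamStar Uf ρ₀ * t - ARZ.U Uf ρ₀ * t = x - ρ₀ * Uf * t := by
    intro x t
    rw [ARZ.lamStar]
    ring
  have arg2 : ∀ x t : ℝ, x + ARZ.lamStar Uf ρ₀ * t - (ARZ.U Uf ρ₀ - ρ₀ * p) * t =
      x - ρ₀ * (Uf - p) * t := by
    intro x t
    rw [ARZ.lamStar]
    ring
  have l2 : ARZ.lam2 Uf h ρ₀ = ρ₀ * (Uf - p) := by rw [ARZ.lam2, hh]
  rw [l2, show ARZ.lam1 Uf ρ₀ = ρ₀ * Uf from rfl]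
  -- The Galilean shift turns the speeds U(ρ₀) and U(ρ₀) - ρ₀p into λ₁⁰ and λ₂⁰, and the solution
  -- takes the form of one operator on w plus one on v.
  have eu : ARZ.moving Uf ρ₀ (fun x t => ARZ.velChar μ ν
        (fun y => deriv h ρ₀ * ρᵢ y + 1 * uᵢ y) (fun y => 0 * ρᵢ y + -1 * uᵢ y)
        (x - ARZ.U Uf ρ₀ * t) (x - (ARZ.U Uf ρ₀ - ρ₀ * deriv h ρ₀) * t)) = fun x t =>
      -μ * ARZ.kerInt μ ν 0 0 (fun y => p * ρᵢ y + 1 * uᵢ y) (x - ρ₀ * Uf * t)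
        (x - ρ₀ * (Uf - p) * t) + -1 * ARZ.selfL μ ν (fun y => 0 * ρᵢ y + -1 * uᵢ y)
        (x - ρ₀ * Uf * t) (x - ρ₀ * (Uf - p) * t) := by
    funext x t
    simp only [ARZ.moving, ARZ.velChar, hh, arg1, arg2, ARZ.waveL]
    ring
  have eρ : ARZ.moving Uf ρ₀ (fun x t => ARZ.densChar μ ν (deriv h ρ₀)
        (fun y => deriv h ρ₀ * ρᵢ y + 1 * uᵢ y) (fun y => 0 * ρᵢ y + -1 * uᵢ y)
        (x - ARZ.U Uf ρ₀ * t) (x - (ARZ.U Uf ρ₀ - ρ₀ * deriv h ρ₀) * t)) = fun x t =>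
      p⁻¹ * (ARZ.selfR μ ν (fun y => p * ρᵢ y + 1 * uᵢ y) (x - ρ₀ * Uf * t)
          (x - ρ₀ * (Uf - p) * t) +
        μ * ARZ.kerInt μ ν 0 0 (fun y => p * ρᵢ y + 1 * uᵢ y) (x - ρ₀ * Uf * t)
          (x - ρ₀ * (Uf - p) * t)) +
      p⁻¹ * (ν * ARZ.kerInt μ ν 0 0 (fun y => 0 * ρᵢ y + -1 * uᵢ y) (x - ρ₀ * Uf * t)
          (x - ρ₀ * (Uf - p) * t) +
        ARZ.selfL μ ν (fun y => 0 * ρᵢ y + -1 * uᵢ y) (x - ρ₀ * Uf * t)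
          (x - ρ₀ * (Uf - p) * t)) := by
    funext x t
    simp only [ARZ.moving, ARZ.densChar, hh, arg1, arg2, ARZ.waveL, ARZ.waveR]
    ring
  rw [eu, eρ]
  refine (add_le_add Bu Bρ).trans_eq ?_
  ring
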